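/- **Setting.** Let $F$ be a nonempty class of real-valued functions on a measurable space $\mathcal X$. The pair $(X,Y)\in\mathcal X\times\mathbb R$ has an unknown law $P$, and $\mu$ is the law of $X$. The data $\mathcal D_N=(X_i,Y_i)_{i=1}^N$ consist of $N$ independent copies of $(X,Y)$. Norms $\|\cdot\|_{L_q}$ are taken with respect to $\mu$ or $P$, and $D$ is the unit ball of $L_2(\mu)$. **Complexity parameters.** Let $\varepsilon_1,\dots,\varepsilon_N$ be independent symmetric random signs, independent of the data. For $h\in F$ and $r>0$ put $$F_{h,r}=\{u\in\mathrm{star}(F-h,0):\|u\|_{L_2}\le r\},\qquad \mathrm{star}(G,0)=\{\lambda g:\ g\in G,\ 0\le\lambda\le1\}.$$ Let $\mathcal M(H,\epsilon D)$ be the largest cardinality (possibly $\infty$) of a subset of $H$ whose distinct elements are at $L_2(\mu)$-distance at least $\epsilon$. For $\kappa>0$ and $0<\eta<1$ define $$\lambda_Q(\kappa,\eta,h)=\inf\{r>0:\log\mathcal M(F_{h,r},\eta rD)\le\kappa^2N\},$$ $$\lambda_M(\kappa,\eta,h)=\inf\{r>0:\log\mathcal M(F_{h,r},\eta rD)\le\kappa^2Nr^2\},$$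 $$r_E(\kappa,h)=\inf\Big\{r>0:\mathbb E\sup_{u\in F_{h,r}}\Big|\tfrac1{\sqrt N}\sum_{i=1}^N\varepsilon_iu(X_i)\Big|\le\kappa\sqrt N\,r\Big\},$$ $$\bar r_M(\kappa,h)=\inf\Big\{r>0:\mathbb E\sup_{u\in F_{h,r}}\Big|\tfrac1{\sqrt N}\sum_{i=1}^N\varepsilon_iu(X_i)(h(X_i)-Y_i)\Big|\le\kappa\sqrt N\,r^2\Big\},$$ with $\inf\emptyset=+\infty$. **Assumption** (with constants $L$ and $\sigma$). $F\subset L_2(\mu)$ is convex and, as a subset of $L_2(\mu)$, locally compact; $Y\in L_2$; the risk $\mathbb E(f(X)-Y)^2$ attains its minimum over $f\in F$ at $f^*\in F$; and - $\|f-h\|_{L_4}\le L\|f-h\|_{L_2}$ for all $f,h\in F$; - $\|f(X)-Y\|_{L_4}\le L\|f(X)-Y\|_{L_2}$ for all $f\in F$; - $\|f^*(X)-Y\|_{L_2}\le\sigma$. As usual, $F$ is also assumed to be pointwise measurable: it has a countable subclass $F_0$ such that, off a single $\mu$-null set, every $f\in F$ is the pointwise limit of a sequence from $F_0$. **Theorem.**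 For every $L\ge1$ there are constants $c,c_0,c_1>0$ and $0<c_2<1$, depending only on $L$, such that the following holds. Let $F$ be as above, $N\in\mathbb N$, $\sigma>0$ and $r\ge0$. There is a procedure $\Phi:(\mathcal X\times\mathbb R)^N\to F$, which may depend on $F,N,L,\sigma,r$ but not on $P$, such that for every law $P$ of $(X,Y)$ that satisfies the Assumption with $L$ and $\sigma$ and for which $$r\ge 2r^*(f^*),\qquad r^*(f^*)=\max\{\lambda_Q(c_1,c_2,f^*),\ \lambda_M(c_1/\sigma,c_2,f^*),\ r_E(c_1,f^*),\ \bar r_M(c_1,f^*)\},$$ the function $\hat f=\Phi(\mathcal D_N)$ satisfies, with (inner) probability at least $1-\exp\big(-c_0N\min\{1,r^2/\sigma^2\}\big)$, $$\|\hat f-f^*\|_{L_2}\le cr\quad\text{and}\quad\mathbb E\big((\hat f(X)-Y)^2\,\big|\,\mathcal D_N\big)\le\mathbb E(f^*(X)-Y)^2+(cr)^2 .$$ -/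

import Mathlib

open MeasureTheory Filter Topology
open scoped ENNReal

noncomputable section

/-- The star-shaped hull of `G` around `h`: all the functions `lam • f + (1 - lam) • h` with
`0 ≤ lam ≤ 1` and `f ∈ G`. -/
def starShapedHull {X : Type*} (G : Set (X → ℝ)) (h : X → ℝ) : Set (X → ℝ) :=
  {u | ∃ f ∈ G, ∃ lam : ℝ, 0 ≤ lam ∧ lam ≤ 1 ∧ u = lam • f + (1 - lam) • h}

/-- The localization `F_{h,r} = star(F - h, 0) ∩ r D`, where `D` is the unit ball of `L₂(μ)`. -/
def localization {X : Type*} [MeasurableSpace X] (μ : Measure X) (F : Set (X → ℝ))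
    (h : X → ℝ) (r : ℝ) : Set (X → ℝ) :=
  starShapedHull ((fun f => f - h) '' F) 0 ∩ {u | eLpNorm u 2 μ ≤ ENNReal.ofReal r}

/-- The packing number `M(H, ε D)`: the largest cardinality (possibly `⊤`) of a finite subset of `H`
whose distinct elements are at `L₂(μ)`-distance at least `ε`. -/
def l2PackingNumber {X : Type*} [MeasurableSpace X] (μ : Measure X) (H : Set (X → ℝ)) (ε : ℝ) :
    ℕ∞ :=
  ⨆ (A : Finset (X → ℝ)) (_ : (A : Set (X → ℝ)) ⊆ H ∧
      (A : Set (X → ℝ)).Pairwise fun u v => ENNReal.ofReal ε ≤ eLpNorm (u - v) 2 μ),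
    (A.card : ℕ∞)

/-- The infimum of the positive radii that satisfy `p`, with value `⊤` if there are none. -/
def infRadius (p : ℝ → Prop) : ℝ≥0∞ :=
  ⨅ (r : ℝ) (_ : 0 < r ∧ p r), ENNReal.ofReal r

/-- `λ_Q(κ, η, h) = inf {r : log M(F_{h,r}, η r D) ≤ κ² N}`. -/
def lambdaQ {X : Type*} [MeasurableSpace X] (μ : Measure X) (F : Set (X → ℝ)) (N : ℕ)
    (κ η : ℝ) (h : X → ℝ) : ℝ≥0∞ :=
  infRadius fun r =>
    ENNReal.log (l2PackingNumber μ (localization μ F h r) (η * r) : ℝ≥0∞) ≤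
      ((κ ^ 2 * N : ℝ) : EReal)

/-- `λ_M(κ, η, h) = inf {r : log M(F_{h,r}, η r D) ≤ κ² N r²}`. -/
def lambdaM {X : Type*} [MeasurableSpace X] (μ : Measure X) (F : Set (X → ℝ)) (N : ℕ)
    (κ η : ℝ) (h : X → ℝ) : ℝ≥0∞ :=
  infRadius fun r =>
    ENNReal.log (l2PackingNumber μ (localization μ F h r) (η * r) : ℝ≥0∞) ≤
      ((κ ^ 2 * N * r ^ 2 : ℝ) : EReal)

/-- `E sup_{g ∈ G} |N^{-1/2} ∑_{i ≤ N} ε_i g(Z_i)|`, where `Z_1, …, Z_N` are independent with law `ν`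
and `ε` is independent of them and uniform on `{-1, 1}^N`. -/
def rademacherMean {Z : Type*} [MeasurableSpace Z] (ν : Measure Z) (N : ℕ) (G : Set (Z → ℝ)) :
    ℝ≥0∞ :=
  ((2 : ℝ≥0∞) ^ N)⁻¹ * ∑ ε : Fin N → ℤˣ,
    ∫⁻ z : Fin N → Z, ⨆ g ∈ G, ‖(1 / √(N : ℝ)) * ∑ i, (((ε i : ℤˣ) : ℤ) : ℝ) * g (z i)‖ₑ
      ∂(Measure.pi fun _ : Fin N => ν)

/-- `r_E(κ, h) = inf {r : E sup_{u ∈ F_{h,r}} |N^{-1/2} ∑ ε_i u(X_i)| ≤ κ √N r}`. -/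
def rE {X : Type*} [MeasurableSpace X] (μ : Measure X) (F : Set (X → ℝ)) (N : ℕ)
    (κ : ℝ) (h : X → ℝ) : ℝ≥0∞ :=
  infRadius fun r =>
    rademacherMean μ N (localization μ F h r) ≤ ENNReal.ofReal (κ * √(N : ℝ) * r)

/-- `r̄_M(κ, h) = inf {r : E sup_{u ∈ F_{h,r}} |N^{-1/2} ∑ ε_i u(X_i) (h(X_i) - Y_i)| ≤ κ √N r²}`,
where `(X_i, Y_i)` are independent with law `P`. -/
def rMbar {X : Type*} [MeasurableSpace X] (P : Measure (X × ℝ)) (F : Set (X → ℝ)) (N : ℕ)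
    (κ : ℝ) (h : X → ℝ) : ℝ≥0∞ :=
  infRadius fun r =>
    rademacherMean P N
        ((fun (u : X → ℝ) (z : X × ℝ) => u z.1 * (h z.1 - z.2)) '' localization P.fst F h r) ≤
      ENNReal.ofReal (κ * √(N : ℝ) * r ^ 2)

/-- `r^*(h) = max {λ_Q(c₁, c₂, h), λ_M(c₁/σ, c₂, h), r_E(c₁, h), r̄_M(c₁, h)}`; here `P` is the law of
`(X, Y)` and `P.fst` is the law of `X`. -/
def rStar {X : Type*} [MeasurableSpace X] (P : Measure (X × ℝ)) (F : Set (X → ℝ)) (N : ℕ)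
    (σ c₁ c₂ : ℝ) (h : X → ℝ) : ℝ≥0∞ :=
  max (max (lambdaQ P.fst F N c₁ c₂ h) (lambdaM P.fst F N (c₁ / σ) c₂ h))
    (max (rE P.fst F N c₁ h) (rMbar P F N c₁ h))

/-- The class `F`, seen as a set of elements of `L₂(μ)`. -/
def l2Classes {X : Type*} [MeasurableSpace X] (μ : Measure X) (F : Set (X → ℝ)) :
    Set (Lp ℝ 2 μ) :=
  {g | ∃ f ∈ F, g =ᵐ[μ] f}

/-- The usual measurability condition on a class of functions: some countable subclass `F₀` is such
that, off one `μ`-null set, every `f ∈ F` is the pointwise limit of a sequence from `F₀`. It makes the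
suprema of the empirical processes indexed by `F` measurable. -/
def PointwiseMeasurableClass {X : Type*} [MeasurableSpace X] (μ : Measure X)
    (F : Set (X → ℝ)) : Prop :=
  ∃ F₀ ⊆ F, F₀.Countable ∧ ∃ Z : Set X, μ Z = 0 ∧
    ∀ f ∈ F, ∃ s : ℕ → X → ℝ, (∀ k, s k ∈ F₀) ∧
      ∀ x, x ∉ Z → Tendsto (fun k => s k x) atTop (𝓝 (f x))

/-- `h` minimizes the risk `E (f(X) - Y)²` over `f ∈ F`. -/
def IsRiskMinimizer {X : Type*} [MeasurableSpace X] (P : Measure (X × ℝ)) (F : Set (X → ℝ))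
    (h : X → ℝ) : Prop :=
  h ∈ F ∧ ∀ f ∈ F, ∫ z, (h z.1 - z.2) ^ 2 ∂P ≤ ∫ z, (f z.1 - z.2) ^ 2 ∂P

/-- The standing assumption on the learning problem: `P` is the law of `(X, Y)`, the function `fstar`
is the minimizer of the risk in `F`, and norms in `L_q` are taken with respect to the law of `X` or
of `(X, Y)`. -/
structure LearningAssumption {X : Type*} [MeasurableSpace X] (P : Measure (X × ℝ))
    (F : Set (X → ℝ)) (fstar : X → ℝ) (L σ : ℝ) : Prop where
  memLp_class : ∀ f ∈ F, MemLp f 2 P.fst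
  memLp_target : MemLp (fun z : X × ℝ => z.2) 2 P
  convex : Convex ℝ F
  locallyCompact : LocallyCompactSpace (l2Classes P.fst F)
  measurableClass : PointwiseMeasurableClass P.fst F
  minimizer : IsRiskMinimizer P F fstar
  norm_equiv_class : ∀ f ∈ F, ∀ h ∈ F,
    eLpNorm (f - h) 4 P.fst ≤ ENNReal.ofReal L * eLpNorm (f - h) 2 P.fst
  norm_equiv_target : ∀ f ∈ F,
    eLpNorm (fun z : X × ℝ => f z.1 - z.2) 4 P ≤
      ENNReal.ofReal L * eLpNorm (fun z : X × ℝ => f z.1 - z.2) 2 P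
  noise_level : eLpNorm (fun z : X × ℝ => fstar z.1 - z.2) 2 P ≤ ENNReal.ofReal σ

end

/-! The estimator is of median-of-means type. The sample is cut into `n` blocks of size `m`, with
`n` of order `N min(1, r²/σ²)`, and any `f` is chosen whose excess empirical risk against every
competitor is at most `2αr²` on at least half of the blocks, where `α = 1/(512 L⁴)`.

On a block, the excess of `f` over `fstar` is `Q + 2M`, with `Q` the block mean of `(f - fstar)²`
and `M` that of `(f - fstar)(fstar - Y)`. Convexity gives `E M ≥ 0`. After `f - fstar` is shrunk to
norm at most `r`, two deviations matter: that of the multiplier block mean, at scale `α r²`, and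
that of the block mean of `|f - fstar|`, at scale `r / (8L²)`. The second suffices for `Q`:
Cauchy-Schwarz on the block bounds `Q` below by the square of the mean of `|f - fstar|`, and the
`L₄`-`L₂` equivalence bounds `E|f - fstar|` below by `‖f - fstar‖ / (4L²)`. If for each `f` both
deviations are small on three quarters of the blocks, a distant `f` has excess at least `6αr²`
there, while `fstar` is accepted. Three quarters and one half of the blocks intersect, so an
accepted `f` is close to `fstar` and has small excess risk (`excess_lower_bound`,
`medianCriterion_analysis`).

Uniformity over `f` comes from bounding the number of bad blocks by `∑ j, min 1 (|deviation| /
scale)`. The supremum of this sum changes by at most 1 with one block, so it concentrates by bounded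
differences. Its expectation is bounded by symmetrizing over blocks, removing the truncation by
contraction, and symmetrizing again over the sample; this leaves the Rademacher averages that `rE`
and `rMbar` control (`integral_ciSup_block_deviation_le`, `measure_block_deviation`). The class is
reduced to a sequence by pointwise measurability, and the moment equivalence turns pointwise
convergence into `L₂` convergence (`tendsto_sqrt_integral_sq_of_ae`).

When `N min(1, r²/σ²)` is bounded, the target probability of failure is at least 1/2 and one block
is enough. There `lambdaQ` or `lambdaM` forces a packing number below 2, so the whole class lies
within `r` of `fstar`, and Markov's inequality handles the multiplier term. -/

/-! ### Contraction for Rademacher averages -/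

/-- Let `k` and `l` attain the two suprema on the left. According to the sign of `q k - q l`, the
pair `(k, l)` or the pair `(l, k)` is a competitor on the right. -/
theorem ciSup_add_ciSup_sub_le {ι : Type*} [Finite ι] [Nonempty ι] (a p q : ι → ℝ)
    (hpq : ∀ k l, |p k - p l| ≤ |q k - q l|) :
    (⨆ k, (a k + p k)) + (⨆ k, (a k - p k)) ≤ (⨆ k, (a k + q k)) + (⨆ k, (a k - q k)) := by
  obtain ⟨k, hk⟩ := exists_eq_ciSup_of_finite (f := fun k => a k + p k)
  obtain ⟨l, hl⟩ := exists_eq_ciSup_of_finite (f := fun k => a k - p k)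
  rw [← hk, ← hl]
  have h1 (i) := le_ciSup (Finite.bddAbove_range fun k => a k + q k) i
  have h2 (i) := le_ciSup (Finite.bddAbove_range fun k => a k - q k) i
  have := (le_abs_self _).trans (hpq k l)
  rcases abs_cases (q k - q l) with ⟨h, -⟩ | ⟨h, -⟩
  · have := h1 k; have := h2 l; linarith
  · have := h1 l; have := h2 k; linarith

/-- The average over all the sign patterns of `sup_k ∑ i, ε i * t k i`. -/
noncomputable def rademacherAverage {ι κ : Type*} [Fintype κ] [DecidableEq κ] (t : ι → κ → ℝ) : ℝ :=
  ((2 : ℝ) ^ Fintype.card κ)⁻¹ * ∑ ε : κ → ℤˣ, ⨆ k, ∑ i, (((ε i : ℤˣ) : ℤ) : ℝ) * t k i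

/-- One coordinate of the contraction principle: sign patterns that differ only at `j` are paired,
and each pair is an instance of `ciSup_add_ciSup_sub_le`. -/
theorem sum_ciSup_signs_update_le {ι κ : Type*} [Finite ι] [Nonempty ι] [Fintype κ]
    [DecidableEq κ] (t t' : ι → κ → ℝ) (j : κ) (hne : ∀ k i, i ≠ j → t k i = t' k i)
    (hj : ∀ k l, |t k j - t l j| ≤ |t' k j - t' l j|) :
    ∑ ε : κ → ℤˣ, ⨆ k, ∑ i, (((ε i : ℤˣ) : ℤ) : ℝ) * t k i ≤
      ∑ ε : κ → ℤˣ, ⨆ k, ∑ i, (((ε i : ℤˣ) : ℤ) : ℝ) * t' k i := by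
  let flip : (κ → ℤˣ) ≃ (κ → ℤˣ) := Equiv.mulLeft (Pi.mulSingle j (-1))
  have hflip (s : ι → κ → ℝ) : ∑ ε : κ → ℤˣ, ⨆ k, ∑ i, (((ε i : ℤˣ) : ℤ) : ℝ) * s k i =
      ∑ ε : κ → ℤˣ, ⨆ k, ∑ i, (((flip ε i : ℤˣ) : ℤ) : ℝ) * s k i :=
    (Equiv.sum_comp flip fun ε => ⨆ k, ∑ i, (((ε i : ℤˣ) : ℤ) : ℝ) * s k i).symm
  have hsplit (s : ι → κ → ℝ) (ε : κ → ℤˣ) (k : ι) :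
      ∑ i, (((ε i : ℤˣ) : ℤ) : ℝ) * s k i =
        ∑ i ∈ Finset.univ.erase j, (((ε i : ℤˣ) : ℤ) : ℝ) * s k i +
          (((ε j : ℤˣ) : ℤ) : ℝ) * s k j := by
    rw [Finset.sum_erase_add _ _ (Finset.mem_univ j)]
  have hsplit' (s : ι → κ → ℝ) (ε : κ → ℤˣ) (k : ι) :
      ∑ i, (((flip ε i : ℤˣ) : ℤ) : ℝ) * s k i =
        ∑ i ∈ Finset.univ.erase j, (((ε i : ℤˣ) : ℤ) : ℝ) * s k i -
          (((ε j : ℤˣ) : ℤ) : ℝ) * s k j := by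
    rw [hsplit, sub_eq_add_neg]
    congr 1
    · refine Finset.sum_congr rfl fun i hi => ?_
      simp [flip, Pi.mulSingle_eq_of_ne (Finset.ne_of_mem_erase hi)]
    · simp [flip]
  have key (ε : κ → ℤˣ) :
      (⨆ k, ∑ i, (((ε i : ℤˣ) : ℤ) : ℝ) * t k i) +
          (⨆ k, ∑ i, (((flip ε i : ℤˣ) : ℤ) : ℝ) * t k i) ≤
        (⨆ k, ∑ i, (((ε i : ℤˣ) : ℤ) : ℝ) * t' k i) +
          (⨆ k, ∑ i, (((flip ε i : ℤˣ) : ℤ) : ℝ) * t' k i) := by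
    simp only [hsplit']
    simp only [hsplit]
    have hrest (k : ι) : ∑ i ∈ Finset.univ.erase j, (((ε i : ℤˣ) : ℤ) : ℝ) * t k i =
        ∑ i ∈ Finset.univ.erase j, (((ε i : ℤˣ) : ℤ) : ℝ) * t' k i :=
      Finset.sum_congr rfl fun i hi => by rw [hne k i (Finset.ne_of_mem_erase hi)]
    simp only [hrest]
    refine ciSup_add_ciSup_sub_le _ _ _ fun k l => ?_
    rw [← mul_sub, ← mul_sub, abs_mul, abs_mul]
    exact mul_le_mul_of_nonneg_left (hj k l) (abs_nonneg _)
  have := Finset.sum_le_sum fun ε (_ : ε ∈ Finset.univ) => key ε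
  rw [Finset.sum_add_distrib, Finset.sum_add_distrib, ← hflip, ← hflip] at this
  linarith

/-- The contraction principle. -/
theorem rademacherAverage_contraction {ι κ : Type*} [Finite ι] [Nonempty ι] [Fintype κ]
    [DecidableEq κ] (t t' : ι → κ → ℝ) (h : ∀ i k l, |t k i - t l i| ≤ |t' k i - t' l i|) :
    rademacherAverage t ≤ rademacherAverage t' := by
  refine mul_le_mul_of_nonneg_left ?_ (by positivity)
  -- The coordinates of `t'` are replaced by those of `t` one at a time.
  have main (S : Finset κ) :
      ∑ ε : κ → ℤˣ, ⨆ k, ∑ i, (((ε i : ℤˣ) : ℤ) : ℝ) * (if i ∈ S then t k i else t' k i) ≤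
        ∑ ε : κ → ℤˣ, ⨆ k, ∑ i, (((ε i : ℤˣ) : ℤ) : ℝ) * t' k i := by
    induction S using Finset.induction_on with
    | empty => simp
    | insert j S hjS ih =>
      refine (sum_ciSup_signs_update_le _ _ j ?_ ?_).trans ih
      · intro k i hij
        simp [hij]
      · intro k l
        simpa [hjS] using h j k l
  simpa using main Finset.univ

theorem rademacherAverage_const_mul {ι κ : Type*} [Fintype κ] [DecidableEq κ]
    (c : ℝ) (hc : 0 ≤ c) (t : ι → κ → ℝ) :
    rademacherAverage (fun k i => c * t k i) = c * rademacherAverage t := by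
  unfold rademacherAverage
  rw [mul_left_comm]
  congr 1
  rw [Finset.mul_sum]
  refine Finset.sum_congr rfl fun ε _ => ?_
  rw [Real.mul_iSup_of_nonneg hc]
  refine iSup_congr fun k => ?_
  rw [Finset.mul_sum]
  exact Finset.sum_congr rfl fun i _ => by ring

theorem rademacherAverage_sub_le {ι κ : Type*} [Finite ι] [Nonempty ι] [Fintype κ]
    [DecidableEq κ] (t t' : ι → κ → ℝ) :
    rademacherAverage (fun k i => t k i - t' k i) ≤
      rademacherAverage t + rademacherAverage t' := by
  unfold rademacherAverage
  rw [← mul_add]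
  refine mul_le_mul_of_nonneg_left ?_ (by positivity)
  -- Negating all the signs preserves the average and turns `-t'` into `t'`.
  rw [← Equiv.sum_comp (Equiv.neg (κ → ℤˣ)) (fun ε => ⨆ k, ∑ i, (((ε i : ℤˣ) : ℤ) : ℝ) * t' k i),
    ← Finset.sum_add_distrib]
  refine Finset.sum_le_sum fun ε _ => ciSup_le fun k => ?_
  have h1 := le_ciSup (Finite.bddAbove_range fun k => ∑ i, (((ε i : ℤˣ) : ℤ) : ℝ) * t k i) k
  have h2 := le_ciSup
    (Finite.bddAbove_range fun k => ∑ i, ((((Equiv.neg _ ε) i : ℤˣ) : ℤ) : ℝ) * t' k i) k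
  refine le_trans (le_of_eq ?_) (add_le_add h1 h2)
  simp only [← Finset.sum_add_distrib]
  refine Finset.sum_congr rfl fun i _ => ?_
  simp
  ring

/-! ### Symmetrization -/

theorem abs_ciSup_le_sum {ι : Type*} [Fintype ι] [Nonempty ι] (f : ι → ℝ) :
    |⨆ k, f k| ≤ ∑ k, |f k| := by
  obtain ⟨k, hk⟩ := exists_eq_ciSup_of_finite (f := f)
  rw [← hk]
  exact Finset.single_le_sum (f := fun k => |f k|) (fun _ _ => abs_nonneg _) (Finset.mem_univ k)

theorem MeasureTheory.Integrable.ciSup {ι α : Type*} [Fintype ι] [Nonempty ι]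
    [MeasurableSpace α] {μ : Measure α} {f : ι → α → ℝ} (hf : ∀ k, Integrable (f k) μ)
    (hm : ∀ k, Measurable (f k)) : Integrable (fun x => ⨆ k, f k x) μ := by
  refine (integrable_finsetSum Finset.univ fun k _ => (hf k).abs).mono'
    (Measurable.iSup hm).aestronglyMeasurable (ae_of_all _ fun x => ?_)
  simpa using abs_ciSup_le_sum fun k => f k x

/-- Restriction to the coordinates selected by an injection, arranged in blocks. -/
theorem measurePreserving_blocks {Z κ α β : Type*} [MeasurableSpace Z] (P : Measure Z)
    [IsProbabilityMeasure P] [Fintype κ] [Fintype α] [Fintype β] (e : α × β ↪ κ) :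
    MeasurePreserving (fun (z : κ → Z) a b => z (e (a, b))) (Measure.pi fun _ : κ => P)
      (Measure.pi fun _ : α => Measure.pi fun _ : β => P) := by
  have h1 : ProbabilityTheory.iIndepFun (fun i (z : κ → Z) => z i)
      (Measure.pi fun _ : κ => P) :=
    ProbabilityTheory.iIndepFun_pi (X := fun _ => id) fun _ => aemeasurable_id
  have h2 : (Measure.pi fun _ : κ => P).map (fun z p => z (e p)) =
      Measure.pi fun _ : α × β => P := by
    rw [(h1.precomp e.injective).map_fun_eq_pi_map fun p => (measurable_pi_apply (e p)).aemeasurable]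
    congr 1; ext1 p
    exact (measurePreserving_eval (fun _ : κ => P) (e p)).map_eq
  have h3 : MeasurePreserving (fun (z : κ → Z) p => z (e p)) (Measure.pi fun _ : κ => P)
      (Measure.pi fun _ : α × β => P) := ⟨by fun_prop, h2⟩
  have h4 : MeasurePreserving (MeasurableEquiv.curry α β Z) (Measure.pi fun _ : α × β => P)
      (Measure.pi fun _ : α => Measure.pi fun _ : β => P) := by
    refine ⟨(MeasurableEquiv.curry α β Z).measurable, ?_⟩
    have := Measure.infinitePi_map_curry (X := Z) (fun (_ : α) (_ : β) => P)
    simpa [Measure.infinitePi_eq_pi] using this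
  exact h4.comp h3

theorem measurable_rademacherAverage {ι κ α : Type*} [Fintype ι] [Nonempty ι] [Fintype κ]
    [DecidableEq κ] [MeasurableSpace α] {t : ι → κ → α → ℝ} (ht : ∀ k i, Measurable (t k i)) :
    Measurable fun x => rademacherAverage fun k i => t k i x := by
  unfold rademacherAverage
  refine measurable_const.mul (Finset.measurable_sum _ fun ε _ => Measurable.iSup fun k => ?_)
  exact Finset.measurable_sum _ fun i _ => (ht k i).const_mul _

theorem integrable_rademacherAverage {ι κ α : Type*} [Fintype ι] [Nonempty ι] [Fintype κ]
    [DecidableEq κ] [MeasurableSpace α] {μ : Measure α} {t : ι → κ → α → ℝ}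
    (ht : ∀ k i, Measurable (t k i)) (hi : ∀ k i, Integrable (t k i) μ) :
    Integrable (fun x => rademacherAverage fun k i => t k i x) μ := by
  unfold rademacherAverage
  refine (integrable_finsetSum _ fun ε _ => Integrable.ciSup (fun k => ?_) fun k => ?_).const_mul _
  · exact integrable_finsetSum _ fun i _ => (hi k i).const_mul _
  · exact Finset.measurable_sum _ fun i _ => (ht k i).const_mul _

/-- Symmetrization, for a weighted centred empirical process with weights in `[-1, 1]`. -/
theorem integral_ciSup_le_two_mul_rademacherAverage {ι κ Z : Type*} [Fintype ι] [Nonempty ι]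
    [Fintype κ] [DecidableEq κ] [MeasurableSpace Z] (P : Measure Z) [IsProbabilityMeasure P]
    (g : ι → Z → ℝ) (hm : ∀ k, Measurable (g k)) (hi : ∀ k, Integrable (g k) P)
    (s : κ → ℝ) (hs : ∀ i, |s i| ≤ 1) :
    ∫ z : κ → Z, ⨆ k, ∑ i, s i * (g k (z i) - ∫ x, g k x ∂P) ∂(Measure.pi fun _ => P) ≤
      2 * ∫ z : κ → Z, rademacherAverage (fun k i => g k (z i)) ∂(Measure.pi fun _ => P) := by
  set μ := Measure.pi fun _ : κ => P with hμ
  set ν := Measure.pi fun _ : κ => P.prod P with hν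
  have hm1 (k : ι) (i : κ) : Measurable fun p : κ → Z × Z => g k (p i).1 := by fun_prop
  have hm2 (k : ι) (i : κ) : Measurable fun p : κ → Z × Z => g k (p i).2 := by fun_prop
  have hi1 (k : ι) (i : κ) : Integrable (fun p : κ → Z × Z => g k (p i).1) ν :=
    integrable_comp_eval (μ := fun _ : κ => P.prod P) ((hi k).comp_fst P)
  have hi2 (k : ι) (i : κ) : Integrable (fun p : κ → Z × Z => g k (p i).2) ν :=
    integrable_comp_eval (μ := fun _ : κ => P.prod P) ((hi k).comp_snd P)
  have hmz (k : ι) (i : κ) : Measurable fun z : κ → Z => g k (z i) := by fun_prop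
  have hiz (k : ι) (i : κ) : Integrable (fun z : κ → Z => g k (z i)) μ :=
    integrable_comp_eval (μ := fun _ : κ => P) (hi k)
  have hsi (z : κ → Z) (k : ι) (i : κ) :
      Integrable (fun z' : κ → Z => s i * (g k (z i) - g k (z' i))) μ :=
    ((integrable_const _).sub (hiz k i)).const_mul _
  have hdi (k : ι) (i : κ) :
      Integrable (fun p : κ → Z × Z => s i * (g k (p i).1 - g k (p i).2)) ν :=
    ((hi1 k i).sub (hi2 k i)).const_mul _
  have hdm (k : ι) (i : κ) :
      Measurable (fun p : κ → Z × Z => s i * (g k (p i).1 - g k (p i).2)) := by fun_prop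
  set H : (κ → Z × Z) → ℝ := fun p => ⨆ k, ∑ i, s i * (g k (p i).1 - g k (p i).2) with hH
  have hHm : Measurable H := Measurable.iSup fun k => by fun_prop
  have hHi : Integrable H ν := Integrable.ciSup
    (fun k => integrable_finsetSum _ fun i _ => hdi k i) (fun k => by fun_prop)
  -- Ghost sample: the mean is an integral over an independent copy, and the supremum of an integral
  -- is at most the integral of the supremum.
  have hA : ∫ z, ⨆ k, ∑ i, s i * (g k (z i) - ∫ x, g k x ∂P) ∂μ ≤ ∫ p, H p ∂ν := by
    have hmp := measurePreserving_arrowProdEquivProdArrow Z Z κ (fun _ => P) (fun _ => P)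
    set e := MeasurableEquiv.arrowProdEquivProdArrow Z Z κ
    have h1 : ∫ p, H p ∂ν = ∫ q, H (e.symm q) ∂(μ.prod μ) :=
      ((hmp.symm e).integral_comp' (fun p => H p)).symm
    have hHi' : Integrable (fun q => H (e.symm q)) (μ.prod μ) :=
      ((hmp.symm e).integrable_comp_emb e.symm.measurableEmbedding).2 hHi
    rw [h1, integral_prod _ hHi']
    refine integral_mono (Integrable.ciSup (fun k => ?_) fun k => by fun_prop)
      hHi'.integral_prod_left fun z => ciSup_le fun k => ?_
    · exact integrable_finsetSum _ fun i _ => ((hiz k i).sub (integrable_const _)).const_mul _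
    · have h2 : ∑ i, s i * (g k (z i) - ∫ x, g k x ∂P) =
          ∫ z' : κ → Z, ∑ i, s i * (g k (z i) - g k (z' i)) ∂μ := by
        rw [integral_finsetSum _ fun i _ => hsi z k i]
        refine Finset.sum_congr rfl fun i _ => ?_
        rw [integral_const_mul, integral_sub (integrable_const _) (hiz k i),
          integral_comp_eval (μ := fun _ : κ => P) (hm k).aestronglyMeasurable]
        simp
      rw [h2]
      refine integral_mono (g := fun z' : κ → Z => ⨆ l, ∑ i, s i * (g l (z i) - g l (z' i)))
        (integrable_finsetSum _ fun i _ => hsi z k i)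
        (Integrable.ciSup (fun l => integrable_finsetSum _ fun i _ => hsi z l i)
          fun l => by fun_prop) fun z' => ?_
      exact le_ciSup (Finite.bddAbove_range fun k => ∑ i, s i * (g k (z i) - g k (z' i))) k
  -- Exchanging the two members of the `i`-th pair whenever `ε i = -1` preserves the law and flips
  -- the sign of the `i`-th difference.
  have hB (ε : κ → ℤˣ) : ∫ p, H p ∂ν =
      ∫ p, ⨆ k, ∑ i, (((ε i : ℤˣ) : ℤ) : ℝ) * (s i * (g k (p i).1 - g k (p i).2)) ∂ν := by
    let T (i : κ) : Z × Z → Z × Z := if ε i = 1 then id else Prod.swap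
    have hT (i : κ) : MeasurePreserving (T i) (P.prod P) (P.prod P) := by
      by_cases h : ε i = 1
      · simpa [T, h] using MeasurePreserving.id _
      · simpa [T, h] using Measure.measurePreserving_swap
    have hmp : MeasurePreserving (fun (p : κ → Z × Z) i => T i (p i)) ν ν :=
      measurePreserving_pi (fun _ : κ => P.prod P) (fun _ => P.prod P) hT
    have h1 : ∫ p, H p ∂ν = ∫ p, H (fun i => T i (p i)) ∂ν := by
      conv_lhs => rw [← hmp.map_eq]
      exact integral_map hmp.measurable.aemeasurable hHm.aestronglyMeasurable
    rw [h1]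
    congr 1; ext p
    refine iSup_congr fun k => Finset.sum_congr rfl fun i _ => ?_
    rcases Int.units_eq_one_or (ε i) with h | h
    · simp [T, h]
    · have : ¬ ((-1 : ℤˣ) = 1) := by decide
      simp [T, h, this]
      ring
  have hC : ∫ p, H p ∂ν =
      ∫ p, rademacherAverage (fun k i => s i * (g k (p i).1 - g k (p i).2)) ∂ν := by
    unfold rademacherAverage
    rw [integral_const_mul, integral_finsetSum]
    · simp only [← hB]
      simp
    · intro ε _
      exact Integrable.ciSup (fun k => integrable_finsetSum _ fun i _ => (hdi k i).const_mul _)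
        fun k => by fun_prop
  -- Since `|s i| ≤ 1`, the weights disappear by contraction. Zero weights are allowed, so sums over
  -- part of the sample are covered.
  have hD : ∫ p, H p ∂ν ≤ ∫ p : κ → Z × Z, (rademacherAverage (fun k i => g k (p i).1) +
      rademacherAverage (fun k i => g k (p i).2)) ∂ν := by
    rw [hC]
    refine integral_mono (integrable_rademacherAverage hdm hdi)
      ((integrable_rademacherAverage hm1 hi1).add (integrable_rademacherAverage hm2 hi2))
      fun p => ?_
    refine le_trans (rademacherAverage_contraction _ (fun k i => g k (p i).1 - g k (p i).2) ?_)
      (rademacherAverage_sub_le _ _)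
    intro i k l
    rw [← mul_sub, abs_mul]
    exact mul_le_of_le_one_left (abs_nonneg _) (hs i)
  refine hA.trans (hD.trans (le_of_eq ?_))
  rw [integral_add (integrable_rademacherAverage hm1 hi1) (integrable_rademacherAverage hm2 hi2),
    two_mul]
  have hm' := measurable_rademacherAverage hmz
  have e1 : MeasurePreserving (fun (p : κ → Z × Z) i => (p i).1) ν μ :=
    measurePreserving_pi (fun _ : κ => P.prod P) (fun _ => P) fun _ => measurePreserving_fst
  have e2 : MeasurePreserving (fun (p : κ → Z × Z) i => (p i).2) ν μ :=
    measurePreserving_pi (fun _ : κ => P.prod P) (fun _ => P) fun _ => measurePreserving_snd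
  congr 1
  · rw [← e1.map_eq, integral_map e1.measurable.aemeasurable hm'.aestronglyMeasurable]
  · rw [← e2.map_eq, integral_map e2.measurable.aemeasurable hm'.aestronglyMeasurable]

/-! ### Bounded differences -/

/-- Induction on `n`: averaging over the first coordinate gives a function `g` with the same bounded
differences, and the fluctuation of `f` around `g` is handled by Hoeffding's lemma, at the cost of a
factor `exp (s² / 2)`. -/
theorem integral_exp_bounded_differences {B : Type*} [MeasurableSpace B] (P : Measure B)
    [IsProbabilityMeasure P] (s : ℝ) (n : ℕ) (f : (Fin n → B) → ℝ) (hf : Measurable f) (M : ℝ)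
    (hM : ∀ x, |f x| ≤ M)
    (hd : ∀ j x y, (∀ i, i ≠ j → x i = y i) → |f x - f y| ≤ 1) :
    ∫ x, Real.exp (s * (f x - ∫ y, f y ∂(Measure.pi fun _ => P))) ∂(Measure.pi fun _ => P) ≤
      Real.exp (n * s ^ 2 / 2) := by
  induction n with
  | zero =>
    have h (x : Fin 0 → B) : f x = f default := congrArg f (Subsingleton.elim _ _)
    simp [h]
  | succ n ih =>
    set μ := Measure.pi fun _ : Fin n => P
    have hmp := measurePreserving_piFinSuccAbove (fun _ : Fin (n + 1) => P) 0
    set e := MeasurableEquiv.piFinSuccAbove (fun _ : Fin (n + 1) => B) 0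
    have hint (φ : (Fin (n + 1) → B) → ℝ) : ∫ x, φ x ∂(Measure.pi fun _ => P) =
        ∫ q, φ (e.symm q) ∂(P.prod μ) := ((hmp.symm e).integral_comp' φ).symm
    have he (b : B) (x : Fin n → B) : e.symm (b, x) = Fin.cons b x := by
      simp [e, MeasurableEquiv.piFinSuccAbove, Fin.insertNthEquiv]
    set f' : B × (Fin n → B) → ℝ := fun q => f (e.symm q) with hf'
    have hfm : Measurable f' := hf.comp e.symm.measurable
    have hfi : Integrable f' (P.prod μ) :=
      (integrable_const M).mono' hfm.aestronglyMeasurable (ae_of_all _ fun q => hM _)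
    have hfix (x) : Integrable (fun b => f' (b, x)) P :=
      (integrable_const M).mono' (hfm.comp (measurable_id.prodMk measurable_const)).aestronglyMeasurable
        (ae_of_all _ fun q => hM _)
    set g : (Fin n → B) → ℝ := fun x => ∫ b, f' (b, x) ∂P with hg
    have hgm : Measurable g := (hfm.stronglyMeasurable.integral_prod_left').measurable
    have hgM (x) : |g x| ≤ M := by
      refine (abs_integral_le_integral_abs).trans ?_
      have := integral_mono (hfix x).abs (integrable_const M) fun b => hM _
      simpa using this
    have hgd (j : Fin n) (x y : Fin n → B) (hxy : ∀ i, i ≠ j → x i = y i) : |g x - g y| ≤ 1 := by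
      rw [hg]
      dsimp only
      rw [← integral_sub (hfix x) (hfix y)]
      refine (abs_integral_le_integral_abs).trans ?_
      have := integral_mono ((hfix x).sub (hfix y)).abs (integrable_const (1 : ℝ)) fun b => by
        simp only [hf', he, Pi.sub_apply]
        refine hd j.succ _ _ fun i hij => ?_
        refine Fin.cases (by simp) (fun i hij => ?_) i hij
        simpa using hxy i fun h => hij (by rw [h])
      simpa using this
    have hEg : ∫ x, f x ∂(Measure.pi fun _ => P) = ∫ x, g x ∂μ := by
      rw [hint, integral_prod_symm _ hfi]
    set E := ∫ x, g x ∂μ with hE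
    have hEM : |E| ≤ M := by
      refine (abs_integral_le_integral_abs).trans ?_
      have := integral_mono_of_nonneg (ae_of_all _ fun x => abs_nonneg (g x))
        (integrable_const (μ := μ) M) (ae_of_all _ hgM)
      simpa using this
    have hexp (x : ℝ) (h : |x| ≤ M + M) : |Real.exp (s * x)| ≤ Real.exp (|s| * (M + M)) := by
      rw [abs_of_pos (Real.exp_pos _), Real.exp_le_exp]
      calc s * x ≤ |s * x| := le_abs_self _
        _ = |s| * |x| := abs_mul _ _
        _ ≤ _ := mul_le_mul_of_nonneg_left h (abs_nonneg _)
    have hei : Integrable (fun q => Real.exp (s * (f' q - E))) (P.prod μ) :=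
      (integrable_const (Real.exp (|s| * (M + M)))).mono' (by fun_prop)
        (ae_of_all _ fun q => hexp _ ((abs_sub _ _).trans (add_le_add (hM _) hEM)))
    have hgi : Integrable (fun x => Real.exp (s * (g x - E))) μ :=
      (integrable_const (Real.exp (|s| * (M + M)))).mono' (by fun_prop)
        (ae_of_all _ fun q => hexp _ ((abs_sub _ _).trans (add_le_add (hgM _) hEM)))
    have hin (x : Fin n → B) : ∫ b, Real.exp (s * (f' (b, x) - E)) ∂P ≤
        Real.exp (s ^ 2 / 2) * Real.exp (s * (g x - E)) := by
      obtain ⟨b₀⟩ : Nonempty B := nonempty_of_isProbabilityMeasure P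
      -- The reference point `b₀` gives an interval of length 2, although the oscillation is at most
      -- 1; this is where the optimal constant is lost.
      have hsub := ProbabilityTheory.hasSubgaussianMGF_of_mem_Icc (μ := P)
        (X := fun b => f' (b, x)) (a := f' (b₀, x) - 1) (b := f' (b₀, x) + 1)
        (hfm.comp (measurable_id.prodMk measurable_const)).aemeasurable
        (ae_of_all _ fun b => by
          have : |f' (b, x) - f' (b₀, x)| ≤ 1 := by
            simp only [hf', he]
            refine hd 0 _ _ fun i hi => ?_
            refine Fin.cases (fun h => absurd rfl h) (fun i _ => by simp) i hi
          constructor <;> linarith [abs_le.1 this])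
      have h := hsub.mgf_le s
      have hc : (((‖f' (b₀, x) + 1 - (f' (b₀, x) - 1)‖₊ / 2) ^ 2 : NNReal) : ℝ) = 1 := by
        push_cast
        rw [show f' (b₀, x) + 1 - (f' (b₀, x) - 1) = 2 by ring]
        norm_num
      rw [hc] at h
      have h2 : ∫ b, Real.exp (s * (f' (b, x) - E)) ∂P =
          Real.exp (s * (g x - E)) * ∫ b, Real.exp (s * (f' (b, x) - g x)) ∂P := by
        rw [← integral_const_mul]
        congr 1; ext b
        rw [← Real.exp_add]; congr 1; ring
      rw [h2, mul_comm]
      refine mul_le_mul_of_nonneg_right ?_ (Real.exp_pos _).le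
      simpa [ProbabilityTheory.mgf, hg] using h
    rw [hEg, hint, integral_prod_symm _ hei]
    calc ∫ x, ∫ b, Real.exp (s * (f' (b, x) - E)) ∂P ∂μ
        ≤ ∫ x, Real.exp (s ^ 2 / 2) * Real.exp (s * (g x - E)) ∂μ :=
          integral_mono hei.integral_prod_right (hgi.const_mul _) hin
      _ = Real.exp (s ^ 2 / 2) * ∫ x, Real.exp (s * (g x - E)) ∂μ := integral_const_mul _ _
      _ ≤ Real.exp (s ^ 2 / 2) * Real.exp (n * s ^ 2 / 2) :=
          mul_le_mul_of_nonneg_left (ih g hgm hgM hgd) (Real.exp_pos _).le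
      _ = Real.exp ((n + 1 : ℕ) * s ^ 2 / 2) := by
          rw [← Real.exp_add]; congr 1; push_cast; ring

/-- McDiarmid's inequality, with a constant that is not optimal. -/
theorem measureReal_bounded_differences_le {B : Type*} [MeasurableSpace B] (P : Measure B)
    [IsProbabilityMeasure P] (n : ℕ) (f : (Fin n → B) → ℝ) (hf : Measurable f) (M : ℝ)
    (hM : ∀ x, |f x| ≤ M)
    (hd : ∀ j x y, (∀ i, i ≠ j → x i = y i) → |f x - f y| ≤ 1) (t : ℝ) (ht : 0 ≤ t) :
    (Measure.pi fun _ => P).real {x | t ≤ f x - ∫ y, f y ∂(Measure.pi fun _ => P)} ≤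
      Real.exp (-t ^ 2 / (2 * n)) := by
  set μ := Measure.pi fun _ : Fin n => P
  have h : ProbabilityTheory.HasSubgaussianMGF (fun x => f x - ∫ y, f y ∂μ) (n : NNReal) μ := by
    refine ⟨fun s => ?_, fun s => ?_⟩
    · refine ProbabilityTheory.integrable_exp_mul_of_mem_Icc (a := -M - ∫ y, f y ∂μ)
        (b := M - ∫ y, f y ∂μ) (by fun_prop) (ae_of_all _ fun x => ?_)
      have := abs_le.1 (hM x)
      constructor <;> linarith
    · simpa [ProbabilityTheory.mgf] using integral_exp_bounded_differences P s n f hf M hM hd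
  simpa using h.measure_ge_le ht

/-! ### Deviations of block means, uniformly over a finite class -/

/-- The average of `φ` over the `j`-th block of the sample `z`; the blocks are given by `e`. -/
noncomputable def blockMean {κ Z : Type*} {n m : ℕ} (e : Fin n × Fin m ↪ κ) (φ : Z → ℝ)
    (z : κ → Z) (j : Fin n) : ℝ :=
  (m : ℝ)⁻¹ * ∑ i, φ (z (e (j, i)))

theorem integral_abs_mean_sub_le {Z : Type*} [MeasurableSpace Z] (P : Measure Z)
    [IsProbabilityMeasure P] {m : ℕ} (hm : 0 < m) (φ : Z → ℝ) (hφ : MemLp φ 2 P) (v : ℝ)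
    (hv : ∫ x, φ x ^ 2 ∂P ≤ v) :
    ∫ b : Fin m → Z, |(m : ℝ)⁻¹ * ∑ i, φ (b i) - ∫ x, φ x ∂P| ∂(Measure.pi fun _ => P) ≤
      √(v / m) := by
  set μ := Measure.pi fun _ : Fin m => P
  set a := ∫ x, φ x ∂P
  have hm' : (0 : ℝ) < m := by exact_mod_cast hm
  have hev (i : Fin m) : MemLp (fun b : Fin m → Z => φ (b i)) 2 μ :=
    hφ.comp_measurePreserving (measurePreserving_eval (fun _ : Fin m => P) i)
  have hsum : MemLp (∑ i, fun b : Fin m → Z => φ (b i)) 2 μ :=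
    memLp_finsetSum' Finset.univ fun i _ => hev i
  set Y : (Fin m → Z) → ℝ := fun b => (m : ℝ)⁻¹ * (∑ i, fun b : Fin m → Z => φ (b i)) b with hY
  have hYL : MemLp Y 2 μ := hsum.const_mul _
  have hYa : ∫ b, Y b ∂μ = a := by
    have hYb : Y = fun b => (m : ℝ)⁻¹ * ∑ i, φ (b i) := by ext b; simp [hY]
    rw [hYb, integral_const_mul, integral_finsetSum _ fun i _ => (hev i).integrable (by norm_num)]
    have hint (i : Fin m) : ∫ b : Fin m → Z, φ (b i) ∂μ = a :=
      integral_comp_eval (μ := fun _ : Fin m => P) hφ.aestronglyMeasurable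
    simp only [hint, Finset.sum_const, Finset.card_univ, Fintype.card_fin, nsmul_eq_mul]
    field_simp
  have hvar : ProbabilityTheory.variance Y μ ≤ v / m := by
    rw [hY, ProbabilityTheory.variance_const_mul,
      ProbabilityTheory.variance_sum_pi (X := fun _ => φ) fun _ => hφ]
    simp only [Finset.sum_const, Finset.card_univ, Fintype.card_fin, nsmul_eq_mul]
    have : ProbabilityTheory.variance φ P ≤ v :=
      (ProbabilityTheory.variance_le_expectation_sq hφ.aestronglyMeasurable).trans
        (by simpa using hv)
    calc ((m : ℝ)⁻¹) ^ 2 * (m * ProbabilityTheory.variance φ P)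
        = ProbabilityTheory.variance φ P / m := by field_simp
      _ ≤ v / m := by gcongr
  have hWL : MemLp (fun b => |Y b - a|) 2 μ := (hYL.sub (memLp_const a)).abs
  have h1 := ProbabilityTheory.variance_nonneg (fun b => |Y b - a|) μ
  rw [ProbabilityTheory.variance_eq_sub hWL] at h1
  rw [ProbabilityTheory.variance_eq_integral hYL.aestronglyMeasurable.aemeasurable, hYa] at hvar
  have h2 : ∫ b, ((fun b => |Y b - a|) ^ 2) b ∂μ = ∫ b, (Y b - a) ^ 2 ∂μ := by
    congr 1; ext b; simp
  rw [h2] at h1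
  -- Nonnegativity of the variance of `|Y - a|` is the inequality between its first and second
  -- moments.
  have h3 : ∫ b, |Y b - a| ∂μ ≤ √(v / m) :=
    Real.le_sqrt_of_sq_le (by linarith)
  simpa [hY] using h3

theorem abs_min_one_div_sub_le (x y α : ℝ) (hα : 0 < α) :
    |min 1 (|x| / α) - min 1 (|y| / α)| ≤ |α⁻¹ * x - α⁻¹ * y| := by
  refine (abs_min_sub_min_le_max _ _ _ _).trans ?_
  rw [sub_self, abs_zero, max_eq_right (abs_nonneg _), ← sub_div, abs_div, ← mul_sub, abs_mul,
    abs_of_pos hα, abs_of_pos (inv_pos.2 hα), div_eq_inv_mul]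
  exact mul_le_mul_of_nonneg_left (abs_abs_sub_abs_le _ _) (inv_pos.2 hα).le

theorem min_one_div_mem (x α : ℝ) (hα : 0 < α) : 0 ≤ min 1 (|x| / α) ∧ min 1 (|x| / α) ≤ 1 :=
  ⟨le_min zero_le_one (div_nonneg (abs_nonneg _) hα.le), min_le_left _ _⟩

/-- For fixed block signs, the signed sum of block means is `1/m` times a weighted centred sum over
the whole sample, so symmetrization applies to it. -/
theorem integral_rademacherAverage_mean_le {ι κ Z : Type*} [Fintype ι] [Nonempty ι] [Fintype κ]
    [DecidableEq κ] [MeasurableSpace Z] (P : Measure Z) [IsProbabilityMeasure P]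
    {n m : ℕ} (hm : 0 < m) (e : Fin n × Fin m ↪ κ)
    (g : ι → Z → ℝ) (hgm : ∀ k, Measurable (g k)) (hg : ∀ k, Integrable (g k) P) (R : ℝ)
    (hR : ∫ z : κ → Z, rademacherAverage (fun k i => g k (z i)) ∂(Measure.pi fun _ => P) ≤ R)
    (a : ι → ℝ) (ha : ∀ k, a k = ∫ x, g k x ∂P) :
    ∫ b : Fin n → Fin m → Z,
      rademacherAverage (fun k j => (m : ℝ)⁻¹ * ∑ i, g k (b j i) - a k)
        ∂(Measure.pi fun _ => Measure.pi fun _ => P) ≤ 2 * R / m := by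
  have hm' : (0 : ℝ) < m := by exact_mod_cast hm
  have hbp := measurePreserving_blocks P e
  set μ := Measure.pi fun _ : Fin n => Measure.pi fun _ : Fin m => P with hμ
  have hmi (k) (j : Fin n) :
      Integrable (fun b : Fin n → Fin m → Z => (m : ℝ)⁻¹ * ∑ i, g k (b j i) - a k) μ := by
    refine Integrable.sub (integrable_comp_eval (μ := fun _ : Fin n => Measure.pi fun _ => P)
      (f := fun b : Fin m → Z => (m : ℝ)⁻¹ * ∑ i, g k (b i)) ?_) (integrable_const _)
    exact (integrable_finsetSum _ fun i _ =>
      integrable_comp_eval (μ := fun _ : Fin m => P) (hg k)).const_mul _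
  unfold rademacherAverage
  rw [integral_const_mul, integral_finsetSum _ fun ε _ =>
    Integrable.ciSup (fun k => integrable_finsetSum _ fun j _ => (hmi k j).const_mul _)
      fun k => by fun_prop]
  have hε (ε : Fin n → ℤˣ) : ∫ b : Fin n → Fin m → Z,
      ⨆ k, ∑ j, (((ε j : ℤˣ) : ℤ) : ℝ) * ((m : ℝ)⁻¹ * ∑ i, g k (b j i) - a k) ∂μ ≤ 2 * R / m := by
    -- The weight is the sign of the block that contains the index, and 0 for the indices that
    -- belong to no block.
    let s : κ → ℝ := Function.extend e (fun p => (((ε p.1 : ℤˣ) : ℤ) : ℝ)) 0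
    have hs (i : κ) : |s i| ≤ 1 := by
      by_cases h : ∃ p, e p = i
      · obtain ⟨p, rfl⟩ := h
        simp only [s, e.injective.extend_apply]
        rcases Int.units_eq_one_or (ε p.1) with h | h <;> simp [h]
      · simp [s, Function.extend_apply' _ _ _ h]
    have hsym := integral_ciSup_le_two_mul_rademacherAverage P g hgm hg s hs
    simp only [← ha] at hsym
    have hchange : ∫ b : Fin n → Fin m → Z,
        ⨆ k, ∑ j, (((ε j : ℤˣ) : ℤ) : ℝ) * ((m : ℝ)⁻¹ * ∑ i, g k (b j i) - a k) ∂μ =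
        (m : ℝ)⁻¹ * ∫ z : κ → Z, ⨆ k, ∑ i, s i * (g k (z i) - a k)
          ∂(Measure.pi fun _ => P) := by
      rw [← hbp.map_eq, integral_map hbp.measurable.aemeasurable
        (Measurable.iSup fun k => by fun_prop).aestronglyMeasurable, ← integral_const_mul]
      congr 1; ext z
      rw [Real.mul_iSup_of_nonneg (inv_pos.2 hm').le]
      refine iSup_congr fun k => ?_
      rw [← Fintype.sum_of_injective e e.injective
        (fun p => (((ε p.1 : ℤˣ) : ℤ) : ℝ) * (g k (z (e p)) - a k)) _
        (fun i hi => by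
          have : s i = 0 := by
            simp only [s]
            rw [Function.extend_apply' _ _ _ (by simpa using hi)]; rfl
          rw [this, zero_mul])
        (fun p => by simp only [s, e.injective.extend_apply]),
        Fintype.sum_prod_type, Finset.mul_sum]
      refine Finset.sum_congr rfl fun j _ => ?_
      dsimp only
      rw [← Finset.mul_sum, Finset.sum_sub_distrib, mul_left_comm]
      congr 1
      simp only [Finset.sum_const, Finset.card_univ, Fintype.card_fin, nsmul_eq_mul]
      field_simp
    rw [hchange, div_eq_inv_mul]
    exact mul_le_mul_of_nonneg_left (hsym.trans (by linarith)) (inv_pos.2 hm').le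
  calc _ ≤ ((2 : ℝ) ^ Fintype.card (Fin n))⁻¹ * ∑ ε : Fin n → ℤˣ, 2 * R / m :=
        mul_le_mul_of_nonneg_left (Finset.sum_le_sum fun ε _ => hε ε) (by positivity)
    _ = 2 * R / m := by simp

/-- The truncated deviation of one block has mean at most `√(v / m) / α`, by the variance bound. The
centred part is symmetrized over blocks; contraction removes `min` and the absolute value, since the
truncation is `1/α`-Lipschitz; the signed block means are then bounded by a second symmetrization.
The two symmetrizations give the factor 4. -/
theorem integral_ciSup_block_deviation_le {ι κ Z : Type*} [Fintype ι] [Nonempty ι] [Fintype κ]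
    [DecidableEq κ] [MeasurableSpace Z] (P : Measure Z) [IsProbabilityMeasure P]
    {n m : ℕ} (hm : 0 < m) (e : Fin n × Fin m ↪ κ)
    (g : ι → Z → ℝ) (hgm : ∀ k, Measurable (g k)) (hg : ∀ k, MemLp (g k) 2 P) (v R α : ℝ)
    (hv : ∀ k, ∫ x, g k x ^ 2 ∂P ≤ v) (hα : 0 < α)
    (hR : ∫ z : κ → Z, rademacherAverage (fun k i => g k (z i)) ∂(Measure.pi fun _ => P) ≤ R)
    (a : ι → ℝ) (ha : ∀ k, a k = ∫ x, g k x ∂P) :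
    ∫ b : Fin n → Fin m → Z, ⨆ k, ∑ j, min 1 (|(m : ℝ)⁻¹ * ∑ i, g k (b j i) - a k| / α)
        ∂(Measure.pi fun _ => Measure.pi fun _ => P) ≤
      n * (√(v / m) / α) + 4 * R / (m * α) := by
  have hrad := integral_rademacherAverage_mean_le P hm e g hgm
    (fun k => (hg k).integrable (by norm_num)) R hR a ha
  set PB := Measure.pi fun _ : Fin m => P with hPB
  set μ := Measure.pi fun _ : Fin n => PB with hμ
  set mean : ι → (Fin m → Z) → ℝ := fun k b => (m : ℝ)⁻¹ * ∑ i, g k (b i) - a k with hmean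
  have hmeanm (k) : Measurable (mean k) := by fun_prop
  have hmeani (k) : Integrable (mean k) PB :=
    ((integrable_finsetSum _ fun i _ => integrable_comp_eval (μ := fun _ : Fin m => P)
        ((hg k).integrable (by norm_num))).const_mul _).sub (integrable_const _)
  change ∫ b : Fin n → Fin m → Z, rademacherAverage (fun k j => mean k (b j)) ∂μ ≤ _ at hrad
  change ∫ b : Fin n → Fin m → Z, ⨆ k, ∑ j, min 1 (|mean k (b j)| / α) ∂μ ≤ _
  have hmeanE (k) : ∫ b, |mean k b| ∂PB ≤ √(v / m) := by
    have := integral_abs_mean_sub_le P hm (g k) (hg k) v (hv k)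
    rwa [← ha] at this
  clear_value mean
  set ψ : ι → (Fin m → Z) → ℝ := fun k b => min 1 (|mean k b| / α) with hψ
  have hψm (k) : Measurable (ψ k) := by fun_prop
  have hψ01 (k b) : 0 ≤ ψ k b ∧ ψ k b ≤ 1 := min_one_div_mem _ _ hα
  have hψi (k) : Integrable (ψ k) PB := (integrable_const (1 : ℝ)).mono'
    (hψm k).aestronglyMeasurable (ae_of_all _ fun b => by
      rw [Real.norm_eq_abs, abs_of_nonneg (hψ01 k b).1]; exact (hψ01 k b).2)
  have hψE (k) : ∫ b, ψ k b ∂PB ≤ √(v / m) / α := by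
    calc ∫ b, ψ k b ∂PB ≤ ∫ b, |mean k b| / α ∂PB :=
          integral_mono (hψi k) ((hmeani k).abs.div_const _) fun b => min_le_right _ _
      _ = (∫ b, |mean k b| ∂PB) / α := integral_div _ _
      _ ≤ √(v / m) / α := by
          gcongr
          exact hmeanE k
  have hψiz (k) (j : Fin n) : Integrable (fun b : Fin n → Fin m → Z => ψ k (b j)) μ :=
    integrable_comp_eval (μ := fun _ : Fin n => PB) (hψi k)
  have hmi (k) (j : Fin n) : Integrable (fun b : Fin n → Fin m → Z => mean k (b j)) μ :=
    integrable_comp_eval (μ := fun _ : Fin n => PB) (hmeani k)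
  have hsym := integral_ciSup_le_two_mul_rademacherAverage (κ := Fin n) PB ψ hψm hψi
    (fun _ => 1) (by simp)
  have hcon : ∫ b : Fin n → Fin m → Z, rademacherAverage (fun k j => ψ k (b j)) ∂μ ≤
      α⁻¹ * (2 * R / m) := by
    refine le_trans ?_ (mul_le_mul_of_nonneg_left hrad (inv_pos.2 hα).le)
    rw [← integral_const_mul]
    have hm1 (k) (j : Fin n) : Measurable fun b : Fin n → Fin m → Z => mean k (b j) := by fun_prop
    have hm2 (k) (j : Fin n) : Measurable fun b : Fin n → Fin m → Z => ψ k (b j) := by fun_prop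
    refine integral_mono (integrable_rademacherAverage hm2 hψiz)
      ((integrable_rademacherAverage hm1 hmi).const_mul _) fun b => ?_
    dsimp only
    rw [← rademacherAverage_const_mul _ (inv_pos.2 hα).le]
    exact rademacherAverage_contraction _ _ fun i k l => abs_min_one_div_sub_le _ _ _ hα
  have hi1 : Integrable (fun b : Fin n → Fin m → Z => ⨆ k, ∑ j, ψ k (b j)) μ :=
    Integrable.ciSup (fun k => integrable_finsetSum _ fun j _ => hψiz k j) fun k => by fun_prop
  have hi2 : Integrable (fun b : Fin n → Fin m → Z =>
      ⨆ k, ∑ j, 1 * (ψ k (b j) - ∫ x, ψ k x ∂PB)) μ :=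
    Integrable.ciSup (fun k => integrable_finsetSum _ fun j _ =>
      ((hψiz k j).sub (integrable_const _)).const_mul _) fun k => by fun_prop
  have hle : ∫ b : Fin n → Fin m → Z, ⨆ k, ∑ j, ψ k (b j) ∂μ ≤ ∫ b : Fin n → Fin m → Z,
      ((⨆ k, ∑ j, 1 * (ψ k (b j) - ∫ x, ψ k x ∂PB)) + n * (√(v / m) / α)) ∂μ := by
    refine integral_mono hi1 (hi2.add (integrable_const _)) fun b => ciSup_le fun k => ?_
    have h1 := le_ciSup (Finite.bddAbove_range
      fun k => ∑ j, 1 * (ψ k (b j) - ∫ x, ψ k x ∂PB)) k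
    have h2 : ∑ j, ψ k (b j) =
        ∑ j, 1 * (ψ k (b j) - ∫ x, ψ k x ∂PB) + n * ∫ x, ψ k x ∂PB := by
      simp
    rw [h2]
    exact add_le_add h1 (mul_le_mul_of_nonneg_left (hψE k) (Nat.cast_nonneg n))
  rw [integral_add hi2 (integrable_const _)] at hle
  simp only [integral_const, probReal_univ, one_smul] at hle
  have h3 : 2 * (α⁻¹ * (2 * R / m)) = 4 * R / (m * α) := by field_simp; ring
  linarith

theorem abs_ciSup_sum_sub_le_one {ι B : Type*} [Finite ι] [Nonempty ι] {n : ℕ} (ψ : ι → B → ℝ)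
    (hψ : ∀ k b, 0 ≤ ψ k b ∧ ψ k b ≤ 1) (j : Fin n) (x y : Fin n → B)
    (hxy : ∀ i, i ≠ j → x i = y i) :
    |(⨆ k, ∑ i, ψ k (x i)) - ⨆ k, ∑ i, ψ k (y i)| ≤ 1 := by
  have main (x y : Fin n → B) (hxy : ∀ i, i ≠ j → x i = y i) :
      (⨆ k, ∑ i, ψ k (x i)) ≤ (⨆ k, ∑ i, ψ k (y i)) + 1 := by
    refine ciSup_le fun k => ?_
    have h1 : ∑ i, ψ k (x i) ≤ ∑ i, ψ k (y i) + 1 := by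
      rw [← Finset.sum_erase_add _ _ (Finset.mem_univ j),
        ← Finset.sum_erase_add _ (fun i => ψ k (y i)) (Finset.mem_univ j),
        Finset.sum_congr rfl fun i hi => by rw [hxy i (Finset.ne_of_mem_erase hi)]]
      linarith [(hψ k (x j)).2, (hψ k (y j)).1]
    have := le_ciSup (Finite.bddAbove_range fun k => ∑ i, ψ k (y i)) k
    exact h1.trans (by linarith)
  rw [abs_le]
  have := main x y hxy
  have := main y x fun i hi => (hxy i hi).symm
  constructor <;> linarith

theorem abs_ciSup_sum_le {ι B : Type*} [Finite ι] [Nonempty ι] {n : ℕ} (ψ : ι → B → ℝ)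
    (hψ : ∀ k b, 0 ≤ ψ k b ∧ ψ k b ≤ 1) (x : Fin n → B) :
    |⨆ k, ∑ i, ψ k (x i)| ≤ n := by
  obtain ⟨k, hk⟩ := exists_eq_ciSup_of_finite (f := fun k => ∑ j, ψ k (x j))
  rw [← hk, abs_of_nonneg (Finset.sum_nonneg fun j _ => (hψ k _).1)]
  calc ∑ j, ψ k (x j) ≤ ∑ j : Fin n, (1 : ℝ) := Finset.sum_le_sum fun j _ => (hψ k _).2
    _ = n := by simp

/-- The expectation is at most `n / 16`, so exceeding `n / 8` is a deviation by `n / 16`; the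
exponent is `(n / 16)² / (2n) = n / 512`. -/
theorem measureReal_block_deviation_finite {ι κ Z : Type*} [Fintype ι] [Nonempty ι] [Fintype κ]
    [DecidableEq κ] [MeasurableSpace Z] (P : Measure Z) [IsProbabilityMeasure P]
    {n m : ℕ} (hn : 0 < n) (hm : 0 < m) (e : Fin n × Fin m ↪ κ)
    (g : ι → Z → ℝ) (hgm : ∀ k, Measurable (g k)) (hg : ∀ k, MemLp (g k) 2 P) (v R α : ℝ)
    (hv : ∀ k, ∫ x, g k x ^ 2 ∂P ≤ v) (hα : 0 < α)
    (hR : ∫ z : κ → Z, rademacherAverage (fun k i => g k (z i)) ∂(Measure.pi fun _ => P) ≤ R)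
    (hsmall : n * (√(v / m) / α) + 4 * R / (m * α) ≤ n / 16) :
    (Measure.pi fun _ : κ => P).real {z | ∃ k, (n : ℝ) / 8 <
      ∑ j, min 1 (|blockMean e (g k) z j - ∫ x, g k x ∂P| / α)} ≤ Real.exp (-(n : ℝ) / 512) := by
  have hn' : (0 : ℝ) < n := by exact_mod_cast hn
  have hE := (integral_ciSup_block_deviation_le P hm e g hgm hg v R α hv hα hR
    (fun k => ∫ x, g k x ∂P) fun _ => rfl).trans hsmall
  have hbp := measurePreserving_blocks P e
  let ψ : ι → (Fin m → Z) → ℝ :=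
    fun k b => min 1 (|(m : ℝ)⁻¹ * ∑ i, g k (b i) - ∫ x, g k x ∂P| / α)
  have hψm (k) : Measurable (ψ k) := by fun_prop
  have hψ01 (k b) : 0 ≤ ψ k b ∧ ψ k b ≤ 1 := min_one_div_mem _ _ hα
  let f : (Fin n → Fin m → Z) → ℝ := fun b => ⨆ k, ∑ j, ψ k (b j)
  have hfm : Measurable f := Measurable.iSup fun k => by fun_prop
  have htail := measureReal_bounded_differences_le (Measure.pi fun _ : Fin m => P) n f hfm n
    (abs_ciSup_sum_le ψ hψ01) (abs_ciSup_sum_sub_le_one ψ hψ01) (n / 16) (by positivity)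
  have hexp : -((n : ℝ) / 16) ^ 2 / (2 * n) = -(n : ℝ) / 512 := by field_simp; norm_num
  rw [hexp] at htail
  refine le_trans ?_ htail
  change ∫ b, f b ∂_ ≤ _ at hE
  set E := ∫ y, f y ∂(Measure.pi fun _ : Fin n => Measure.pi fun _ : Fin m => P)
  have hset : MeasurableSet {x | (n : ℝ) / 16 ≤ f x - E} :=
    measurableSet_le measurable_const (by fun_prop)
  rw [← hbp.measureReal_preimage hset.nullMeasurableSet]
  refine measureReal_mono ?_
  rintro z ⟨k, hk⟩
  have := le_ciSup (Finite.bddAbove_range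
    fun k => ∑ j, ψ k (fun i => z (e (j, i)))) k
  have h1 : (n : ℝ) / 8 < f fun j i => z (e (j, i)) := hk.trans_le this
  show (n : ℝ) / 16 ≤ f (fun j i => z (e (j, i))) - E
  linarith

/-! ### From the complexity parameters to finite families and sequences -/

/-- The average over all the sign patterns of `sup_k |∑ i, ε i * t k i|`. -/
noncomputable def absRademacherAverage {ι κ : Type*} [Fintype κ] [DecidableEq κ]
    (t : ι → κ → ℝ) : ℝ :=
  ((2 : ℝ) ^ Fintype.card κ)⁻¹ * ∑ ε : κ → ℤˣ, ⨆ k, |∑ i, (((ε i : ℤˣ) : ℤ) : ℝ) * t k i|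

theorem rademacherAverage_le_abs {ι κ : Type*} [Finite ι] [Nonempty ι] [Fintype κ]
    [DecidableEq κ] (t : ι → κ → ℝ) : rademacherAverage t ≤ absRademacherAverage t :=
  mul_le_mul_of_nonneg_left (Finset.sum_le_sum fun _ _ =>
    ciSup_mono (Finite.bddAbove_range _) fun _ => le_abs_self _) (by positivity)

theorem rademacherAverage_abs_le {ι κ : Type*} [Finite ι] [Nonempty ι] [Fintype κ]
    [DecidableEq κ] (t : ι → κ → ℝ) :
    rademacherAverage (fun k i => |t k i|) ≤ absRademacherAverage t :=
  (rademacherAverage_contraction _ t fun _ _ _ => abs_abs_sub_abs_le _ _).trans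
    (rademacherAverage_le_abs t)

/-- Adjoining a sign to the index writes an absolute value as a supremum, so two-sided deviations
can go through the one-sided symmetrization. -/
theorem rademacherAverage_signed_le {ι κ : Type*} [Finite ι] [Nonempty ι] [Fintype κ]
    [DecidableEq κ] (t : ι → κ → ℝ) :
    rademacherAverage (fun (p : ι × ℤˣ) i => (((p.2 : ℤˣ) : ℤ) : ℝ) * t p.1 i) ≤
      absRademacherAverage t := by
  refine mul_le_mul_of_nonneg_left (Finset.sum_le_sum fun ε _ => ciSup_le fun p => ?_)
    (by positivity)
  refine le_trans ?_ (le_ciSup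
    (Finite.bddAbove_range fun k => |∑ i, (((ε i : ℤˣ) : ℤ) : ℝ) * t k i|) p.1)
  have : ∑ i, (((ε i : ℤˣ) : ℤ) : ℝ) * ((((p.2 : ℤˣ) : ℤ) : ℝ) * t p.1 i) =
      (((p.2 : ℤˣ) : ℤ) : ℝ) * ∑ i, (((ε i : ℤˣ) : ℤ) : ℝ) * t p.1 i := by
    rw [Finset.mul_sum]
    exact Finset.sum_congr rfl fun i _ => by ring
  rw [this]
  rcases Int.units_eq_one_or p.2 with h | h <;> rw [h]
  · simpa using le_abs_self _
  · simpa using neg_le_abs _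

theorem integrable_absRademacherAverage {ι κ α : Type*} [Fintype ι] [Nonempty ι] [Fintype κ]
    [DecidableEq κ] [MeasurableSpace α] {μ : Measure α} {t : ι → κ → α → ℝ}
    (ht : ∀ k i, Measurable (t k i)) (hi : ∀ k i, Integrable (t k i) μ) :
    Integrable (fun x => absRademacherAverage fun k i => t k i x) μ := by
  unfold absRademacherAverage
  refine (integrable_finsetSum _ fun ε _ => Integrable.ciSup (fun k => ?_) fun k => ?_).const_mul _
  · exact (integrable_finsetSum _ fun i _ => (hi k i).const_mul _).abs
  · fun_prop

theorem ae_pi_of_ae {κ Z : Type*} [Fintype κ] [MeasurableSpace Z] {P : Measure Z}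
    [IsProbabilityMeasure P] {p : Z → Prop} (h : ∀ᵐ x ∂P, p x) :
    ∀ᵐ z : κ → Z ∂(Measure.pi fun _ => P), ∀ i, p (z i) :=
  ae_all_iff.2 fun i =>
    (measurePreserving_eval (fun _ : κ => P) i).quasiMeasurePreserving.ae h

/-- `rademacherMean` is a lower integral of a supremum over an arbitrary class. Only finite
subfamilies are compared with it, through measurable representatives, so no measurability of that
supremum is needed. -/
theorem integral_absRademacherAverage_le {ι Z : Type*} [Fintype ι] [Nonempty ι]
    [MeasurableSpace Z] (P : Measure Z) [IsProbabilityMeasure P] {N : ℕ} (hN : 0 < N)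
    (G : Set (Z → ℝ)) (u g : ι → Z → ℝ) (hum : ∀ k, Measurable (u k))
    (hui : ∀ k, Integrable (u k) P) (hg : ∀ k, g k ∈ G) (hug : ∀ k, u k =ᵐ[P] g k) (B : ℝ)
    (hB : 0 ≤ B) (h : rademacherMean P N G ≤ ENNReal.ofReal (B * √(N : ℝ))) :
    ∫ z : Fin N → Z, absRademacherAverage (fun k i => u k (z i)) ∂(Measure.pi fun _ => P) ≤
      B * N := by
  have hN' : (0 : ℝ) < N := by exact_mod_cast hN
  have hsN : (0 : ℝ) < √(N : ℝ) := Real.sqrt_pos.2 hN'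
  set μ := Measure.pi fun _ : Fin N => P with hμ
  set I : (Fin N → ℤˣ) → ℝ≥0∞ := fun ε =>
    ∫⁻ z : Fin N → Z, ⨆ g ∈ G, ‖(1 / √(N : ℝ)) * ∑ i, (((ε i : ℤˣ) : ℤ) : ℝ) * g (z i)‖ₑ ∂μ
    with hI
  have hmean : rademacherMean P N G = ((2 : ℝ≥0∞) ^ N)⁻¹ * ∑ ε, I ε := rfl
  have hsum : ∑ ε, I ε ≠ ⊤ := by
    intro htop
    rw [hmean, htop, ENNReal.mul_top (by simp)] at h
    exact absurd h (by simp)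
  have hIt (ε) : I ε ≠ ⊤ := ENNReal.sum_ne_top.1 hsum ε (Finset.mem_univ _)
  have hiz (k) (i : Fin N) : Integrable (fun z : Fin N → Z => u k (z i)) μ :=
    integrable_comp_eval (μ := fun _ : Fin N => P) (hui k)
  have hSi (ε : Fin N → ℤˣ) : Integrable (fun z : Fin N → Z =>
      ⨆ k, |∑ i, (((ε i : ℤˣ) : ℤ) : ℝ) * u k (z i)|) μ :=
    Integrable.ciSup (fun k => (integrable_finsetSum _ fun i _ => (hiz k i).const_mul _).abs)
      fun k => by fun_prop
  have hae : ∀ᵐ z ∂μ, ∀ i k, u k (z i) = g k (z i) :=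
    ae_pi_of_ae (ae_all_iff.2 hug)
  have key (ε : Fin N → ℤˣ) :
      ∫ z : Fin N → Z, ⨆ k, |∑ i, (((ε i : ℤˣ) : ℤ) : ℝ) * u k (z i)| ∂μ ≤
        √(N : ℝ) * (I ε).toReal := by
    rw [integral_eq_lintegral_of_nonneg_ae (ae_of_all _ fun z => Real.iSup_nonneg fun k =>
      abs_nonneg _) (hSi ε).aestronglyMeasurable]
    have h1 : ∫⁻ z : Fin N → Z, ENNReal.ofReal
        (⨆ k, |∑ i, (((ε i : ℤˣ) : ℤ) : ℝ) * u k (z i)|) ∂μ ≤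
        ENNReal.ofReal (√(N : ℝ)) * I ε := by
      rw [hI, ← lintegral_const_mul' _ _ ENNReal.ofReal_ne_top]
      refine lintegral_mono_ae ?_
      filter_upwards [hae] with z hz
      obtain ⟨k, hk⟩ := exists_eq_ciSup_of_finite
        (f := fun k => |∑ i, (((ε i : ℤˣ) : ℤ) : ℝ) * u k (z i)|)
      rw [← hk]
      refine le_trans (le_of_eq ?_) (mul_le_mul_right (le_iSup₂_of_le (g k) (hg k) le_rfl) _)
      simp only [hz]
      rw [← ofReal_norm, ← ENNReal.ofReal_mul hsN.le, norm_mul, Real.norm_eq_abs,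
        Real.norm_eq_abs, abs_of_pos (by positivity : 0 < 1 / √(N : ℝ))]
      congr 1
      field_simp
    have h2 := ENNReal.toReal_mono (ENNReal.mul_ne_top ENNReal.ofReal_ne_top (hIt ε)) h1
    rwa [ENNReal.toReal_mul, ENNReal.toReal_ofReal hsN.le] at h2
  unfold absRademacherAverage
  rw [integral_const_mul, integral_finsetSum _ fun ε _ => hSi ε]
  calc _ ≤ ((2 : ℝ) ^ Fintype.card (Fin N))⁻¹ * ∑ ε, √(N : ℝ) * (I ε).toReal :=
        mul_le_mul_of_nonneg_left (Finset.sum_le_sum fun ε _ => key ε) (by positivity)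
    _ = √(N : ℝ) * (rademacherMean P N G).toReal := by
        rw [hmean, ENNReal.toReal_mul, ENNReal.toReal_sum fun ε _ => hIt ε, ← Finset.mul_sum]
        simp
        ring
    _ ≤ √(N : ℝ) * (B * √(N : ℝ)) := by
        gcongr
        exact ENNReal.toReal_le_of_le_ofReal (by positivity) h
    _ = B * N := by
        rw [mul_left_comm, Real.mul_self_sqrt hN'.le]

theorem measure_exists_nat_le {α : Type*} [MeasurableSpace α] (μ : Measure α)
    (p : ℕ → α → Prop) (c : ℝ≥0∞) (h : ∀ K : ℕ, μ {z | ∃ k : Fin (K + 1), p k z} ≤ c) :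
    μ {z | ∃ k, p k z} ≤ c := by
  have hU : {z | ∃ k, p k z} = ⋃ K : ℕ, {z | ∃ k : Fin (K + 1), p k z} := by
    ext z
    simp only [Set.mem_ofPred_eq, Set.mem_iUnion]
    exact ⟨fun ⟨k, hk⟩ => ⟨k, ⟨k, k.lt_succ_self⟩, hk⟩, fun ⟨_, k, hk⟩ => ⟨k, hk⟩⟩
  have hmono : Monotone fun K : ℕ => {z | ∃ k : Fin (K + 1), p k z} := by
    rintro K K' hK z ⟨k, hk⟩
    exact ⟨⟨k, by omega⟩, hk⟩
  rw [hU, hmono.measure_iUnion]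
  exact iSup_le h

/-- With overwhelming probability, most of the block averages of each function of the class are
close to its mean. -/
theorem measure_block_deviation {κ Z : Type*} [Fintype κ]
    [DecidableEq κ] [MeasurableSpace Z] (P : Measure Z) [IsProbabilityMeasure P]
    {n m : ℕ} (hn : 0 < n) (hm : 0 < m) (e : Fin n × Fin m ↪ κ)
    (g : ℕ → Z → ℝ) (hgm : ∀ k, Measurable (g k)) (hg : ∀ k, MemLp (g k) 2 P) (v R α : ℝ)
    (hv : ∀ k, ∫ x, g k x ^ 2 ∂P ≤ v) (hα : 0 < α)
    (hR : ∀ K : ℕ, ∫ z : κ → Z, rademacherAverage (fun (k : Fin (K + 1)) i => g k (z i))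
      ∂(Measure.pi fun _ => P) ≤ R)
    (hsmall : n * (√(v / m) / α) + 4 * R / (m * α) ≤ n / 16) :
    (Measure.pi fun _ : κ => P) {z | ∃ k, (n : ℝ) / 8 <
      ∑ j, min 1 (|blockMean e (g k) z j - ∫ x, g k x ∂P| / α)} ≤
        ENNReal.ofReal (Real.exp (-(n : ℝ) / 512)) := by
  refine measure_exists_nat_le _ _ _ fun K => ?_
  have := measureReal_block_deviation_finite P hn hm e (fun k : Fin (K + 1) => g k)
    (fun k => hgm k) (fun k => hg k) v R α (fun k => hv k) hα (hR K) hsmall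
  exact ENNReal.le_ofReal_iff_toReal_le (measure_ne_top _ _) (Real.exp_pos _).le |>.2 this

/-- The bound for a single block, from Markov's inequality. -/
theorem measure_single_block_deviation {Z : Type*} [MeasurableSpace Z] (P : Measure Z)
    [IsProbabilityMeasure P] {N : ℕ} (hN : 0 < N) (e : Fin 1 × Fin N ↪ Fin N)
    (g : ℕ → Z → ℝ) (hgm : ∀ k, Measurable (g k)) (hg : ∀ k, Integrable (g k) P) (R α : ℝ)
    (hα : 0 < α)
    (hR : ∀ K : ℕ, ∫ z : Fin N → Z, absRademacherAverage (fun (k : Fin (K + 1)) i => g k (z i))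
      ∂(Measure.pi fun _ => P) ≤ R) :
    (Measure.pi fun _ : Fin N => P) {z | ∃ k, (1 : ℝ) / 8 <
      ∑ j, min 1 (|blockMean e (g k) z j - ∫ x, g k x ∂P| / α)} ≤
        ENNReal.ofReal (16 * R / (N * α)) := by
  have hN' : (0 : ℝ) < N := by exact_mod_cast hN
  refine measure_exists_nat_le _ _ _ fun K => ?_
  set μ := Measure.pi fun _ : Fin N => P with hμ
  -- With both signs in the index set, the supremum `H` below dominates the absolute value of every
  -- centred sum.
  set G : Fin (K + 1) × ℤˣ → Z → ℝ := fun p x => (((p.2 : ℤˣ) : ℤ) : ℝ) * g p.1 x with hG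
  have hGm (p) : Measurable (G p) := (hgm _).const_mul _
  have hGi (p) : Integrable (G p) P := (hg _).const_mul _
  have hiz (k : ℕ) (i : Fin N) : Integrable (fun z : Fin N → Z => g k (z i)) μ :=
    integrable_comp_eval (μ := fun _ : Fin N => P) (hg k)
  have hGz (p) (i : Fin N) : Integrable (fun z : Fin N → Z => G p (z i)) μ :=
    integrable_comp_eval (μ := fun _ : Fin N => P) (hGi p)
  have hsym := integral_ciSup_le_two_mul_rademacherAverage (κ := Fin N) P G hGm hGi
    (fun _ => 1) (by simp)
  have hrad : ∫ z : Fin N → Z, rademacherAverage (fun p i => G p (z i)) ∂μ ≤ R := by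
    refine le_trans (integral_mono ?_ ?_ fun z =>
      rademacherAverage_signed_le fun (k : Fin (K + 1)) i => g k (z i)) (hR K)
    · exact integrable_rademacherAverage (fun p i => (hGm p).comp (measurable_pi_apply i)) hGz
    · exact integrable_absRademacherAverage
        (fun k i => (hgm k).comp (measurable_pi_apply i)) fun k i => hiz k i
  set H : (Fin N → Z) → ℝ := fun z => ⨆ p, ∑ i, 1 * (G p (z i) - ∫ x, G p x ∂P) with hH
  have hHi : Integrable H μ := Integrable.ciSup
    (fun p => integrable_finsetSum _ fun i _ => ((hGz p i).sub (integrable_const _)).const_mul _)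
    fun p => by fun_prop
  have hle (z : Fin N → Z) (k : Fin (K + 1)) :
      |∑ i, (g k (z i) - ∫ x, g k x ∂P)| ≤ H z := by
    have h1 (s : ℤˣ) : (((s : ℤˣ) : ℤ) : ℝ) * ∑ i, (g k (z i) - ∫ x, g k x ∂P) ≤ H z := by
      refine le_trans (le_of_eq ?_) (le_ciSup (Finite.bddAbove_range
        fun p => ∑ i, 1 * (G p (z i) - ∫ x, G p x ∂P)) (k, s))
      rw [Finset.mul_sum]
      refine Finset.sum_congr rfl fun i _ => ?_
      simp only [hG, integral_const_mul]
      ring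
    rw [abs_le]
    have h2 := h1 1
    have h3 := h1 (-1)
    simp only [Units.val_one, Units.val_neg, Int.cast_one, Int.cast_neg, one_mul,
      neg_mul] at h2 h3
    constructor <;> linarith
  have hH0 (z) : 0 ≤ H z := (abs_nonneg _).trans (hle z 0)
  -- A truncated ratio above `1/8` forces the block mean to deviate by more than `α / 8`, hence the
  -- centred sum by more than `N α / 8`.
  have hmarkov := mul_meas_ge_le_integral_of_nonneg (ae_of_all _ hH0) hHi (N * (α / 8))
  refine ENNReal.le_ofReal_iff_toReal_le (measure_ne_top _ _) ?_ |>.2 ?_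
  · have : 0 ≤ R := by
      have := integral_nonneg (μ := μ) (f := H) hH0
      linarith
    positivity
  have hsub : {z : Fin N → Z | ∃ k : Fin (K + 1), (1 : ℝ) / 8 <
      ∑ j, min 1 (|blockMean e (g k) z j - ∫ x, g k x ∂P| / α)} ⊆
      {z | N * (α / 8) ≤ H z} := by
    rintro z ⟨k, hk⟩
    refine le_trans ?_ (hle z k)
    rw [Fin.sum_univ_one] at hk
    have h1 := hk.trans_le (min_le_right _ _)
    rw [lt_div_iff₀ hα] at h1
    have h2 : ∑ i, (g k (z i) - ∫ x, g k x ∂P) =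
        N * (blockMean e (g k) z 0 - ∫ x, g k x ∂P) := by
      -- The single block has as many elements as the sample, so it exhausts it.
      have hb : Function.Bijective fun i : Fin N => e (0, i) :=
        Finite.injective_iff_bijective.1 fun i j h => by simpa using h
      unfold blockMean
      rw [hb.sum_comp (fun i => g k (z i)), mul_sub, ← mul_assoc, mul_inv_cancel₀ hN'.ne']
      simp
    rw [h2, abs_mul, abs_of_pos hN']
    exact mul_le_mul_of_nonneg_left (by linarith) hN'.le
  have hfin := measureReal_mono (μ := μ) hsub
  change μ.real _ ≤ _
  rw [le_div_iff₀ (by positivity)]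
  have : μ.real {z | N * (α / 8) ≤ H z} * (N * α) ≤ 16 * R := by
    nlinarith
  refine le_trans (mul_le_mul_of_nonneg_right hfin (by positivity)) this

/-! ### Moment equivalence and `L₂` convergence -/

theorem integral_abs_mul_le_sqrt {Ω : Type*} [MeasurableSpace Ω] {μ : Measure Ω} {f g : Ω → ℝ}
    (hf : MemLp f 2 μ) (hg : MemLp g 2 μ) :
    ∫ x, |f x * g x| ∂μ ≤ √(∫ x, f x ^ 2 ∂μ) * √(∫ x, g x ^ 2 ∂μ) := by
  have h := integral_mul_le_Lp_mul_Lq_of_nonneg (μ := μ) (f := fun x => |f x|)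
    (g := fun x => |g x|) Real.HolderConjugate.two_two (ae_of_all _ fun x => abs_nonneg _)
    (ae_of_all _ fun x => abs_nonneg _) (by simpa using MemLp.norm hf) (by simpa using MemLp.norm hg)
  simpa [abs_mul, Real.sqrt_eq_rpow] using h

theorem eLpNorm_two_eq_ofReal_sqrt {Ω : Type*} [MeasurableSpace Ω] {μ : Measure Ω} {f : Ω → ℝ}
    (hf : MemLp f 2 μ) : eLpNorm f 2 μ = ENNReal.ofReal (√(∫ x, f x ^ 2 ∂μ)) := by
  rw [hf.eLpNorm_eq_integral_rpow_norm (by norm_num) (by norm_num)]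
  simp [Real.sqrt_eq_rpow]

theorem integral_pow_four_le {Ω : Type*} [MeasurableSpace Ω] {μ : Measure Ω} {f : Ω → ℝ}
    (hf : MemLp f 2 μ) {L : ℝ} (hL : 0 ≤ L)
    (h : eLpNorm f 4 μ ≤ ENNReal.ofReal L * eLpNorm f 2 μ) :
    Integrable (fun x => f x ^ 4) μ ∧ ∫ x, f x ^ 4 ∂μ ≤ L ^ 4 * (∫ x, f x ^ 2 ∂μ) ^ 2 := by
  have h4 : MemLp f 4 μ := ⟨hf.aestronglyMeasurable,
    h.trans_lt (ENNReal.mul_lt_top ENNReal.ofReal_lt_top hf.eLpNorm_lt_top)⟩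
  refine ⟨?_, ?_⟩
  · have := h4.integrable_norm_pow (p := 4) (by norm_num)
    simpa [Even.pow_abs (by decide : Even 4)] using this
  · rw [eLpNorm_two_eq_ofReal_sqrt hf, ← ENNReal.ofReal_mul hL,
      h4.eLpNorm_eq_integral_rpow_norm (by norm_num) (by norm_num),
      ENNReal.ofReal_le_ofReal_iff (by positivity)] at h
    have h0 : 0 ≤ ∫ x, f x ^ 4 ∂μ := integral_nonneg fun x => by positivity
    have h1 : (∫ x, f x ^ 4 ∂μ) ^ ((4 : ℝ)⁻¹) ≤ L * √(∫ x, f x ^ 2 ∂μ) := by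
      have e1 : ∀ x, ‖f x‖ ^ ((4 : ℝ≥0∞).toReal) = f x ^ 4 := fun x => by
        rw [show ((4 : ℝ≥0∞).toReal) = ((4 : ℕ) : ℝ) by norm_num, Real.rpow_natCast,
          Real.norm_eq_abs, Even.pow_abs (by decide : Even 4)]
      simp only [e1] at h
      simpa only [ENNReal.toReal_ofNat] using h
    have h2 := pow_le_pow_left₀ (by positivity) h1 4
    rw [← Real.rpow_natCast, ← Real.rpow_mul h0] at h2
    norm_num at h2
    refine h2.trans (le_of_eq ?_)
    rw [mul_pow, show (√(∫ x, f x ^ 2 ∂μ)) ^ 4 = ((√(∫ x, f x ^ 2 ∂μ)) ^ 2) ^ 2 by ring,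
      Real.sq_sqrt (integral_nonneg fun x => by positivity)]

/-- A lower bound on truncated first moments in terms of second moments, when fourth and second
moments are equivalent. -/
theorem sqrt_integral_sq_le_truncation {Ω : Type*} [MeasurableSpace Ω] {μ : Measure Ω}
    [IsProbabilityMeasure μ] {f : Ω → ℝ} (hf : MemLp f 2 μ) {L : ℝ} (hL : 0 < L)
    (hi : Integrable (fun x => f x ^ 4) μ)
    (h4 : ∫ x, f x ^ 4 ∂μ ≤ L ^ 4 * (∫ x, f x ^ 2 ∂μ) ^ 2) :
    √(∫ x, f x ^ 2 ∂μ) ≤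
      4 * L ^ 2 * (1 + 2 * L ^ 2 * √(∫ x, f x ^ 2 ∂μ)) * ∫ x, min 1 |f x| ∂μ := by
  set ρ := √(∫ x, f x ^ 2 ∂μ) with hρ
  have hρ2 : ρ ^ 2 = ∫ x, f x ^ 2 ∂μ := Real.sq_sqrt (integral_nonneg fun x => by positivity)
  have hmin : Integrable (fun x => min 1 |f x|) μ := by
    refine (integrable_const (1 : ℝ)).mono'
      (aestronglyMeasurable_const.inf hf.aestronglyMeasurable.norm) (ae_of_all _ fun x => ?_)
    rw [Real.norm_eq_abs, abs_of_nonneg (le_min zero_le_one (abs_nonneg _))]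
    exact min_le_left _ _
  have hmin0 : 0 ≤ ∫ x, min 1 |f x| ∂μ :=
    integral_nonneg fun x => le_min zero_le_one (abs_nonneg _)
  have hρ0 : 0 ≤ ρ := Real.sqrt_nonneg _
  rcases hρ0.eq_or_lt with h0 | hpos
  · rw [← h0]; positivity
  -- At this truncation level the part of `f` above `t` carries at most `ρ² / 4` of the second
  -- moment, because `(t²)⁻¹ * L⁴ρ⁴ = ρ² / 4`.
  set t := 2 * L ^ 2 * ρ with ht
  have htpos : 0 < t := by positivity
  have hpt (x : Ω) : f x ^ 2 ≤ t * (1 + t) * min 1 |f x| + (t ^ 2)⁻¹ * f x ^ 4 := by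
    rw [← sq_abs (f x), show f x ^ 4 = |f x| ^ 4 from (Even.pow_abs (by decide) _).symm]
    set y := |f x|
    have hy : 0 ≤ y := abs_nonneg _
    by_cases hyt : y ≤ t
    · have h1 : y ^ 2 ≤ t * (1 + t) * min 1 y := by
        rcases le_total 1 y with h | h
        · rw [min_eq_left h]; nlinarith
        · rw [min_eq_right h]; nlinarith [mul_nonneg hy htpos.le, mul_nonneg hy (sq_nonneg t)]
      have : 0 ≤ (t ^ 2)⁻¹ * y ^ 4 := by positivity
      linarith
    · push Not at hyt
      have h1 : y ^ 2 ≤ (t ^ 2)⁻¹ * y ^ 4 := by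
        rw [le_inv_mul_iff₀ (by positivity)]
        have : t ^ 2 ≤ y ^ 2 := by gcongr
        nlinarith [mul_le_mul_of_nonneg_right this (sq_nonneg y)]
      have : 0 ≤ t * (1 + t) * min 1 y := by positivity
      linarith
  have hint := integral_mono hf.integrable_sq ((hmin.const_mul (t * (1 + t))).add
    (hi.const_mul (t ^ 2)⁻¹)) hpt
  simp only [Pi.add_apply] at hint
  rw [integral_add (hmin.const_mul _) (hi.const_mul _), integral_const_mul,
    integral_const_mul, ← hρ2] at hint
  have h5 : (t ^ 2)⁻¹ * ∫ x, f x ^ 4 ∂μ ≤ ρ ^ 2 / 4 := by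
    rw [inv_mul_le_iff₀ (by positivity)]
    refine h4.trans (le_of_eq ?_)
    rw [← hρ2, ht]; ring
  have h6 : ρ * ρ ≤ ρ * (4 * L ^ 2 * (1 + t) * ∫ x, min 1 |f x| ∂μ) := by
    have : t * (1 + t) * ∫ x, min 1 |f x| ∂μ =
      ρ * (2 * L ^ 2 * (1 + t) * ∫ x, min 1 |f x| ∂μ) := by rw [ht]; ring
    rw [this] at hint
    have h7 : 0 ≤ ρ * (2 * L ^ 2 * (1 + t) * ∫ x, min 1 |f x| ∂μ) := by positivity
    nlinarith
  exact le_of_mul_le_mul_left h6 hpos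

/-- A lower bound on first moments in terms of second moments, when fourth and second
moments are equivalent. -/
theorem sqrt_integral_sq_le_integral_abs {Ω : Type*} [MeasurableSpace Ω] {μ : Measure Ω}
    [IsProbabilityMeasure μ] {f : Ω → ℝ} (hf : MemLp f 2 μ) {L : ℝ} (hL : 0 < L)
    (hi : Integrable (fun x => f x ^ 4) μ)
    (h4 : ∫ x, f x ^ 4 ∂μ ≤ L ^ 4 * (∫ x, f x ^ 2 ∂μ) ^ 2) :
    √(∫ x, f x ^ 2 ∂μ) ≤ 4 * L ^ 2 * ∫ x, |f x| ∂μ := by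
  set ρ := √(∫ x, f x ^ 2 ∂μ) with hρ
  have hρ2 : ρ ^ 2 = ∫ x, f x ^ 2 ∂μ := Real.sq_sqrt (integral_nonneg fun x => by positivity)
  have habs : Integrable (fun x => |f x|) μ := (hf.integrable (by norm_num)).abs
  have habs0 : 0 ≤ ∫ x, |f x| ∂μ := integral_nonneg fun x => abs_nonneg _
  have hρ0 : 0 ≤ ρ := Real.sqrt_nonneg _
  rcases hρ0.eq_or_lt with h0 | hpos
  · rw [← h0]; positivity
  set t := 2 * L ^ 2 * ρ with ht
  have htpos : 0 < t := by positivity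
  have hpt (x : Ω) : f x ^ 2 ≤ t * |f x| + (t ^ 2)⁻¹ * f x ^ 4 := by
    rw [← sq_abs (f x), show f x ^ 4 = |f x| ^ 4 from (Even.pow_abs (by decide) _).symm]
    set y := |f x|
    have hy : 0 ≤ y := abs_nonneg _
    by_cases hyt : y ≤ t
    · have : 0 ≤ (t ^ 2)⁻¹ * y ^ 4 := by positivity
      nlinarith
    · push Not at hyt
      have h1 : y ^ 2 ≤ (t ^ 2)⁻¹ * y ^ 4 := by
        rw [le_inv_mul_iff₀ (by positivity)]
        have : t ^ 2 ≤ y ^ 2 := by gcongr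
        nlinarith [mul_le_mul_of_nonneg_right this (sq_nonneg y)]
      have : 0 ≤ t * y := by positivity
      linarith
  have hint := integral_mono hf.integrable_sq ((habs.const_mul t).add
    (hi.const_mul (t ^ 2)⁻¹)) hpt
  simp only [Pi.add_apply] at hint
  rw [integral_add (habs.const_mul _) (hi.const_mul _), integral_const_mul,
    integral_const_mul, ← hρ2] at hint
  have h5 : (t ^ 2)⁻¹ * ∫ x, f x ^ 4 ∂μ ≤ ρ ^ 2 / 4 := by
    rw [inv_mul_le_iff₀ (by positivity)]
    refine h4.trans (le_of_eq ?_)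
    rw [← hρ2, ht]; ring
  have h6 : ρ * ρ ≤ ρ * (4 * L ^ 2 * ∫ x, |f x| ∂μ) := by
    have : t * ∫ x, |f x| ∂μ = ρ * (2 * L ^ 2 * ∫ x, |f x| ∂μ) := by rw [ht]; ring
    rw [this] at hint
    have h7 : 0 ≤ ρ * (2 * L ^ 2 * ∫ x, |f x| ∂μ) := by positivity
    nlinarith
  exact le_of_mul_le_mul_left h6 hpos

/-- The moment equivalence replaces a dominating function: the truncated first moments tend to 0 by
dominated convergence, and they control the `L₂` norms through `sqrt_integral_sq_le_truncation`. -/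
theorem tendsto_sqrt_integral_sq_of_ae {Ω : Type*} [MeasurableSpace Ω] {μ : Measure Ω}
    [IsProbabilityMeasure μ] {d : ℕ → Ω → ℝ} (hd : ∀ k, MemLp (d k) 2 μ) {L : ℝ} (hL : 0 < L)
    (hi : ∀ k, Integrable (fun x => d k x ^ 4) μ)
    (h4 : ∀ k, ∫ x, d k x ^ 4 ∂μ ≤ L ^ 4 * (∫ x, d k x ^ 2 ∂μ) ^ 2)
    (hlim : ∀ᵐ x ∂μ, Tendsto (fun k => d k x) atTop (𝓝 0)) :
    Tendsto (fun k => √(∫ x, d k x ^ 2 ∂μ)) atTop (𝓝 0) := by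
  have hφ : Tendsto (fun k => ∫ x, min 1 |d k x| ∂μ) atTop (𝓝 0) := by
    have := tendsto_integral_of_dominated_convergence (μ := μ) (F := fun k x => min 1 |d k x|)
      (f := fun _ => 0) (fun _ => 1)
      (fun k => aestronglyMeasurable_const.inf (hd k).aestronglyMeasurable.norm)
      (integrable_const _) (fun k => ae_of_all _ fun x => by
        rw [Real.norm_eq_abs, abs_of_nonneg (le_min zero_le_one (abs_nonneg _))]
        exact min_le_left _ _) ?_
    · simpa using this
    · filter_upwards [hlim] with x hx
      have := (tendsto_const_nhds (x := (1 : ℝ))).min hx.abs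
      simpa using this
  -- Below this threshold the term `8 L⁴ ρ φ` is at most `ρ / 2` and is absorbed on the left, which
  -- leaves `ρ ≤ 8 L² φ`.
  have hsmall : ∀ᶠ k in atTop, ∫ x, min 1 |d k x| ∂μ < (16 * L ^ 4)⁻¹ :=
    hφ.eventually (gt_mem_nhds (by positivity))
  have hub : Tendsto (fun k => 8 * L ^ 2 * ∫ x, min 1 |d k x| ∂μ) atTop (𝓝 0) := by
    simpa using hφ.const_mul (8 * L ^ 2)
  refine tendsto_of_tendsto_of_tendsto_of_le_of_le' tendsto_const_nhds hub
    (Eventually.of_forall fun k => Real.sqrt_nonneg _) ?_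
  filter_upwards [hsmall] with k hk
  have h := sqrt_integral_sq_le_truncation (hd k) hL (hi k) (h4 k)
  set ρ := √(∫ x, d k x ^ 2 ∂μ)
  set φ := ∫ x, min 1 |d k x| ∂μ
  have hρ : 0 ≤ ρ := Real.sqrt_nonneg _
  have hk' : 16 * L ^ 4 * φ < 1 := by
    rwa [← one_div, lt_div_iff₀' (by positivity)] at hk
  nlinarith [mul_nonneg hρ (sub_nonneg.2 hk'.le)]

theorem tendsto_integral_mul_of_sq {Ω : Type*} [MeasurableSpace Ω] {μ : Measure Ω}
    {g : ℕ → Ω → ℝ} {g₀ w : Ω → ℝ} (hg : ∀ k, MemLp (g k) 2 μ)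
    (hg₀ : MemLp g₀ 2 μ) (hw : MemLp w 2 μ)
    (h : Tendsto (fun k => √(∫ x, (g k x - g₀ x) ^ 2 ∂μ)) atTop (𝓝 0)) :
    Tendsto (fun k => ∫ x, g k x * w x ∂μ) atTop (𝓝 (∫ x, g₀ x * w x ∂μ)) := by
  rw [tendsto_iff_dist_tendsto_zero]
  have hub := h.mul_const (√(∫ x, w x ^ 2 ∂μ))
  rw [zero_mul] at hub
  refine squeeze_zero (fun _ => dist_nonneg) (fun k => ?_) hub
  have e1 : Integrable (fun x => g k x * w x) μ := (hg k).integrable_mul hw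
  have e2 : Integrable (fun x => g₀ x * w x) μ := hg₀.integrable_mul hw
  rw [Real.dist_eq, ← integral_sub e1 e2]
  refine abs_integral_le_integral_abs.trans ?_
  refine le_trans (le_of_eq ?_) (integral_abs_mul_le_sqrt ((hg k).sub hg₀) hw)
  congr 1; ext x
  rw [sub_mul]

theorem tendsto_integral_abs_of_sq {Ω : Type*} [MeasurableSpace Ω] {μ : Measure Ω}
    [IsProbabilityMeasure μ] {g : ℕ → Ω → ℝ} {g₀ : Ω → ℝ} (hg : ∀ k, MemLp (g k) 2 μ)
    (hg₀ : MemLp g₀ 2 μ)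
    (h : Tendsto (fun k => √(∫ x, (g k x - g₀ x) ^ 2 ∂μ)) atTop (𝓝 0)) :
    Tendsto (fun k => ∫ x, |g k x| ∂μ) atTop (𝓝 (∫ x, |g₀ x| ∂μ)) := by
  rw [tendsto_iff_dist_tendsto_zero]
  refine squeeze_zero (fun _ => dist_nonneg) (fun k => ?_) h
  have hgi := (hg k).integrable (q := 2) (by norm_num)
  have hgi₀ := hg₀.integrable (q := 2) (by norm_num)
  rw [Real.dist_eq, ← integral_sub hgi.abs hgi₀.abs]
  refine abs_integral_le_integral_abs.trans ?_
  have h1 := integral_abs_mul_le_sqrt ((hg k).sub hg₀) (memLp_const (1 : ℝ))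
  simp only [mul_one, one_pow, integral_const, probReal_univ, smul_eq_mul, Real.sqrt_one] at h1
  refine le_trans (integral_mono (hgi.abs.sub hgi₀.abs).abs (hgi.sub hgi₀).abs fun x => ?_) h1
  exact abs_abs_sub_abs_le _ _

theorem tendsto_integral_sq_of_sq {Ω : Type*} [MeasurableSpace Ω] {μ : Measure Ω}
    {g : ℕ → Ω → ℝ} {g₀ : Ω → ℝ} (hg : ∀ k, MemLp (g k) 2 μ) (hg₀ : MemLp g₀ 2 μ)
    (h : Tendsto (fun k => √(∫ x, (g k x - g₀ x) ^ 2 ∂μ)) atTop (𝓝 0)) :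
    Tendsto (fun k => ∫ x, g k x ^ 2 ∂μ) atTop (𝓝 (∫ x, g₀ x ^ 2 ∂μ)) := by
  have h1 := (h.pow 2).add ((tendsto_integral_mul_of_sq hg hg₀ hg₀ h).const_mul 2)
  have h2 := h1.sub (tendsto_const_nhds (x := ∫ x, g₀ x ^ 2 ∂μ))
  refine (h2.congr fun k => ?_).trans (le_of_eq ?_)
  · rw [Real.sq_sqrt (integral_nonneg fun x => by positivity)]
    have e1 : Integrable (fun x => (g k x - g₀ x) ^ 2) μ := ((hg k).sub hg₀).integrable_sq
    have e2 : Integrable (fun x => 2 * (g k x * g₀ x)) μ :=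
      ((hg k).integrable_mul hg₀).const_mul 2
    rw [← integral_const_mul, ← integral_add e1 e2, sub_eq_iff_eq_add,
      ← integral_add (hg k).integrable_sq hg₀.integrable_sq]
    congr 1; ext x; ring
  · congr 1
    have : ∫ x, g₀ x * g₀ x ∂μ = ∫ x, g₀ x ^ 2 ∂μ := by congr 1; ext x; ring
    rw [this]; ring

theorem integral_sq_mul_sq_le {Ω : Type*} [MeasurableSpace Ω] {μ : Measure Ω}
    {u w : Ω → ℝ} {L r σ : ℝ} (hr : 0 < r) (hσ : 0 < σ)
    (hu : AEStronglyMeasurable u μ) (hw : AEStronglyMeasurable w μ)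
    (hui : Integrable (fun x => u x ^ 4) μ) (hwi : Integrable (fun x => w x ^ 4) μ)
    (hu4 : ∫ x, u x ^ 4 ∂μ ≤ L ^ 4 * r ^ 4) (hw4 : ∫ x, w x ^ 4 ∂μ ≤ L ^ 4 * σ ^ 4) :
    MemLp (fun x => u x * w x) 2 μ ∧
      ∫ x, (u x * w x) ^ 2 ∂μ ≤ L ^ 4 * r ^ 2 * σ ^ 2 := by
  -- This weight in the arithmetic-geometric inequality balances the two fourth moments.
  set t := σ ^ 2 / r ^ 2 with ht
  have htpos : 0 < t := by positivity
  have hpt (x : Ω) : (u x * w x) ^ 2 ≤ t / 2 * u x ^ 4 + t⁻¹ / 2 * w x ^ 4 := by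
    have h : 0 ≤ t⁻¹ / 2 * (t * u x ^ 2 - w x ^ 2) ^ 2 := by positivity
    have h2 : t⁻¹ / 2 * (t * u x ^ 2 - w x ^ 2) ^ 2 =
        t / 2 * u x ^ 4 + t⁻¹ / 2 * w x ^ 4 - (u x * w x) ^ 2 := by field_simp; ring
    linarith
  have hi := (hui.const_mul (t / 2)).add (hwi.const_mul (t⁻¹ / 2))
  have hm : AEStronglyMeasurable (fun x => u x * w x) μ := hu.mul hw
  have hsq : Integrable (fun x => (u x * w x) ^ 2) μ :=
    hi.mono' (hm.pow 2) (ae_of_all _ fun x => by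
      rw [Real.norm_eq_abs, abs_of_nonneg (sq_nonneg _)]; exact hpt x)
  refine ⟨(memLp_two_iff_integrable_sq hm).2 hsq, (integral_mono hsq hi hpt).trans ?_⟩
  simp only [Pi.add_apply]
  rw [integral_add (hui.const_mul _) (hwi.const_mul _), integral_const_mul, integral_const_mul]
  calc t / 2 * ∫ x, u x ^ 4 ∂μ + t⁻¹ / 2 * ∫ x, w x ^ 4 ∂μ
      ≤ t / 2 * (L ^ 4 * r ^ 4) + t⁻¹ / 2 * (L ^ 4 * σ ^ 4) := by gcongr
    _ = L ^ 4 * r ^ 2 * σ ^ 2 := by rw [ht]; field_simp; ring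

/-! ### Counting bad blocks, and passage from a sequence to the class -/

/-- The truncated ratio is a Lipschitz majorant of the indicator that a block is bad; contraction
requires the former, counting the latter. -/
theorem card_le_of_sum_min_le {n : ℕ} (x : Fin n → ℝ) (α c : ℝ) (hα : 0 < α) (hx : ∀ j, 0 ≤ x j)
    (h : ∑ j, min 1 (x j / α) ≤ c) : ((Finset.univ.filter fun j => α ≤ x j).card : ℝ) ≤ c := by
  refine le_trans ?_ h
  calc ((Finset.univ.filter fun j => α ≤ x j).card : ℝ)
      = ∑ j, if α ≤ x j then (1 : ℝ) else 0 := by simp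
    _ ≤ ∑ j, min 1 (x j / α) := Finset.sum_le_sum fun j _ => by
        split_ifs with hj
        · exact le_min le_rfl ((one_le_div hα).2 hj)
        · exact le_min zero_le_one (div_nonneg (hx j) hα.le)

theorem blockMean_congr {κ Z : Type*} {n m : ℕ} (e : Fin n × Fin m ↪ κ) {φ φ' : Z → ℝ}
    {z : κ → Z} (h : ∀ i, φ (z i) = φ' (z i)) (j : Fin n) :
    blockMean e φ z j = blockMean e φ' z j := by
  simp only [blockMean, h]

/-- Deviations over a class are controlled by the deviations over an approximating sequence. -/
theorem measure_class_block_deviation_le {ι κ Z : Type*} [Fintype κ] [MeasurableSpace Z]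
    (P : Measure Z) [IsProbabilityMeasure P] {n m : ℕ} (e : Fin n × Fin m ↪ κ) (c α : ℝ)
    (G : ι → Z → ℝ) (q : ℕ → ι) (u : ℕ → Z → ℝ) (hu : ∀ k, u k =ᵐ[P] G (q k))
    (S : Set Z) (hS : P S = 0)
    (happrox : ∀ f, ∃ s : ℕ → ℕ,
      (∀ x, x ∉ S → Tendsto (fun k => G (q (s k)) x) atTop (𝓝 (G f x))) ∧
      Tendsto (fun k => ∫ x, G (q (s k)) x ∂P) atTop (𝓝 (∫ x, G f x ∂P))) :
    (Measure.pi fun _ : κ => P) {z | ∃ f, c <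
        ∑ j, min 1 (|blockMean e (G f) z j - ∫ x, G f x ∂P| / α)} ≤
      (Measure.pi fun _ : κ => P) {z | ∃ k, c <
        ∑ j, min 1 (|blockMean e (u k) z j - ∫ x, u k x ∂P| / α)} := by
  refine measure_mono_ae ?_
  filter_upwards [ae_pi_of_ae (κ := κ) (ae_all_iff.2 hu),
    ae_pi_of_ae (κ := κ) (measure_eq_zero_iff_ae_notMem.1 hS)] with z hz hzS
  rintro ⟨f, hf⟩
  obtain ⟨s, hs, hsi⟩ := happrox f
  have hlim : Tendsto (fun k => ∑ j, min 1
      (|blockMean e (G (q (s k))) z j - ∫ x, G (q (s k)) x ∂P| / α)) atTop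
      (𝓝 (∑ j, min 1 (|blockMean e (G f) z j - ∫ x, G f x ∂P| / α))) := by
    refine tendsto_finsetSum _ fun j _ => tendsto_const_nhds.min (Tendsto.div_const ?_ _)
    refine (Tendsto.sub ?_ hsi).abs
    exact (tendsto_finsetSum _ fun i _ => hs _ (hzS _)).const_mul _
  -- The strict inequality is an open condition, so it passes from `f` to some member of the
  -- approximating sequence.
  obtain ⟨k, hk⟩ := (hlim.eventually (lt_mem_nhds hf)).exists
  refine ⟨s k, ?_⟩
  rw [integral_congr_ae (hu (s k))]
  convert! hk using 6
  exact blockMean_congr e (fun i => hz i _) _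

/-! ### Deterministic analysis of the acceptance criterion -/

/-- The `L₂` distance, as a real number. -/
noncomputable def l2Radius {X : Type*} [MeasurableSpace X] (μ : Measure X) (h f : X → ℝ) : ℝ :=
  √(∫ x, (f x - h x) ^ 2 ∂μ)

/-- The function `f - h`, shrunk to norm at most `r`. -/
noncomputable def localize {X : Type*} [MeasurableSpace X] (μ : Measure X) (h : X → ℝ) (r : ℝ)
    (f : X → ℝ) : X → ℝ :=
  fun x => r / max r (l2Radius μ h f) * (f x - h x)

theorem l2Radius_nonneg {X : Type*} [MeasurableSpace X] (μ : Measure X) (h f : X → ℝ) :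
    0 ≤ l2Radius μ h f := Real.sqrt_nonneg _

theorem sq_l2Radius {X : Type*} [MeasurableSpace X] (μ : Measure X) (h f : X → ℝ) :
    l2Radius μ h f ^ 2 = ∫ x, (f x - h x) ^ 2 ∂μ :=
  Real.sq_sqrt (integral_nonneg fun _ => by positivity)

/-- Reduces the lower bound on the quadratic term to first moments, whose deviations need only a
second moment of the function. -/
theorem sq_blockMean_abs_le {κ Z : Type*} {n m : ℕ} (hm : 0 < m) (e : Fin n × Fin m ↪ κ)
    (φ : Z → ℝ) (z : κ → Z) (j : Fin n) :
    blockMean e (fun x => |φ x|) z j ^ 2 ≤ blockMean e (fun x => φ x ^ 2) z j := by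
  have hm' : (0 : ℝ) < m := by exact_mod_cast hm
  unfold blockMean
  have h := sq_sum_le_card_mul_sum_sq (s := Finset.univ) (f := fun i => |φ (z (e (j, i)))|)
  simp only [sq_abs, Finset.card_univ, Fintype.card_fin] at h
  rw [mul_pow]
  calc ((m : ℝ)⁻¹) ^ 2 * (∑ i, |φ (z (e (j, i)))|) ^ 2
      ≤ ((m : ℝ)⁻¹) ^ 2 * (m * ∑ i, φ (z (e (j, i))) ^ 2) := by gcongr
    _ = _ := by field_simp

theorem blockMean_const_mul {κ Z : Type*} {n m : ℕ} (e : Fin n × Fin m ↪ κ) (c : ℝ)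
    (φ : Z → ℝ) (z : κ → Z) (j : Fin n) :
    blockMean e (fun x => c * φ x) z j = c * blockMean e φ z j := by
  unfold blockMean
  rw [← Finset.mul_sum, mul_left_comm]

theorem blockMean_nonneg {κ Z : Type*} {n m : ℕ} (e : Fin n × Fin m ↪ κ)
    {φ : Z → ℝ} (h : ∀ x, 0 ≤ φ x) (z : κ → Z) (j : Fin n) : 0 ≤ blockMean e φ z j :=
  mul_nonneg (by positivity) (Finset.sum_nonneg fun _ _ => h _)

theorem blockMean_excess {κ X : Type*} {n m : ℕ} (e : Fin n × Fin m ↪ κ)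
    (f h : X → ℝ) (z : κ → X × ℝ) (j : Fin n) :
    blockMean e (fun z => (f z.1 - z.2) ^ 2 - (h z.1 - z.2) ^ 2) z j =
      blockMean e (fun z => (f z.1 - h z.1) ^ 2) z j +
        2 * blockMean e (fun z => (f z.1 - h z.1) * (h z.1 - z.2)) z j := by
  unfold blockMean
  rw [mul_left_comm, ← mul_add, Finset.mul_sum (a := 2), ← Finset.sum_add_distrib]
  congr 1
  exact Finset.sum_congr rfl fun i _ => by ring

theorem blockMean_neg {κ Z : Type*} {n m : ℕ} (e : Fin n × Fin m ↪ κ)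
    (φ ψ : Z → ℝ) (z : κ → Z) (j : Fin n) :
    blockMean e (fun x => φ x - ψ x) z j = -blockMean e (fun x => ψ x - φ x) z j := by
  unfold blockMean
  rw [← mul_neg, ← Finset.sum_neg_distrib]
  simp

/-- The acceptance criterion of the median-of-means procedure: against every competitor in the
class, the excess empirical risk is at most `τ` on at least half of the blocks. -/
def MedianCriterion {X : Type*} (F : Set (X → ℝ)) {N n m : ℕ} (e : Fin n × Fin m ↪ Fin N) (τ : ℝ)
    (D : Fin N → X × ℝ) (f : X → ℝ) : Prop :=
  ∀ h ∈ F, n ≤ 2 * (Finset.univ.filter fun j =>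
    blockMean e (fun z : X × ℝ => (f z.1 - z.2) ^ 2 - (h z.1 - z.2) ^ 2) D j ≤ τ).card

/-- On a good block, the excess empirical risk is bounded from below. -/
theorem excess_lower_bound {X : Type*} [MeasurableSpace X] {P : Measure (X × ℝ)}
    {fstar f : X → ℝ} {L r α : ℝ} (hL : 0 < L) (hr : 0 < r) (hα : α = (512 * L ^ 4)⁻¹)
    {N n m : ℕ} (hm : 0 < m) (e : Fin n × Fin m ↪ Fin N) (D : Fin N → X × ℝ) (j : Fin n)
    (hE : 0 ≤ ∫ z, (f z.1 - fstar z.1) * (fstar z.1 - z.2) ∂P)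
    (hL1 : l2Radius P.fst fstar f ≤ 4 * L ^ 2 * ∫ x, |f x - fstar x| ∂P.fst)
    (hM : |blockMean e (fun z : X × ℝ => localize P.fst fstar r f z.1 * (fstar z.1 - z.2)) D j -
      ∫ z, localize P.fst fstar r f z.1 * (fstar z.1 - z.2) ∂P| < α * r ^ 2)
    (hQ : r ≤ l2Radius P.fst fstar f →
      |blockMean e (fun x => |localize P.fst fstar r f x|) (fun i => (D i).1) j -
      ∫ x, |localize P.fst fstar r f x| ∂P.fst| < (8 * L ^ 2)⁻¹ * r) :
    (l2Radius P.fst fstar f < r →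
      2 * (∫ z, (f z.1 - fstar z.1) * (fstar z.1 - z.2) ∂P) - 2 * α * r ^ 2 ≤
      blockMean e (fun z : X × ℝ => (f z.1 - z.2) ^ 2 - (fstar z.1 - z.2) ^ 2) D j) ∧
    (r ≤ l2Radius P.fst fstar f → 6 * α * r ^ 2 ≤
      blockMean e (fun z : X × ℝ => (f z.1 - z.2) ^ 2 - (fstar z.1 - z.2) ^ 2) D j) := by
  set ν := l2Radius P.fst fstar f with hν
  set E := ∫ z, (f z.1 - fstar z.1) * (fstar z.1 - z.2) ∂P with hEdef
  have hmax : 0 < max r ν := lt_max_of_lt_left hr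
  set sc := r / max r ν with hsc
  have hscpos : 0 < sc := div_pos hr hmax
  rw [blockMean_excess]
  set Q := blockMean e (fun z : X × ℝ => (f z.1 - fstar z.1) ^ 2) D j with hQdef
  set M := blockMean e (fun z : X × ℝ => (f z.1 - fstar z.1) * (fstar z.1 - z.2)) D j with hMdef
  have hQ0 : 0 ≤ Q := blockMean_nonneg e (fun _ => sq_nonneg _) D j
  -- The localization factor is undone: a deviation at scale `α r²` for the shrunk function is one
  -- at scale `α r max(r, ν)` for the original.
  have hM' : |M - E| < α * r * max r ν := by
    have h1 : blockMean e (fun z : X × ℝ => localize P.fst fstar r f z.1 * (fstar z.1 - z.2)) D j =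
        sc * M := by
      simp only [localize, mul_assoc]
      exact blockMean_const_mul e _ _ D j
    have h2 : ∫ z, localize P.fst fstar r f z.1 * (fstar z.1 - z.2) ∂P = sc * E := by
      simp only [localize, mul_assoc]
      exact integral_const_mul _ _
    rw [h1, h2, ← mul_sub, abs_mul, abs_of_pos hscpos, hsc, div_mul_eq_mul_div,
      div_lt_iff₀ hmax] at hM
    have : r * |M - E| < r * (α * r * max r ν) := by linarith
    exact lt_of_mul_lt_mul_left this hr.le
  have hαpos : 0 < α := by rw [hα]; positivity
  have hM2 := (abs_lt.1 hM').1
  refine ⟨fun h => ?_, fun h => ?_⟩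
  · rw [max_eq_left h.le] at hM2
    nlinarith
  · have hνpos : 0 < ν := hr.trans_le h
    rw [max_eq_right h] at hM2
    have hQ' := hQ h
    set A := blockMean e (fun x => |f x - fstar x|) (fun i => (D i).1) j with hA
    have h1 : blockMean e (fun x => |localize P.fst fstar r f x|) (fun i => (D i).1) j =
        sc * A := by
      simp only [localize, abs_mul]
      rw [blockMean_const_mul, ← hν, ← hsc, abs_of_pos hscpos]
    have h2 : ∫ x, |localize P.fst fstar r f x| ∂P.fst =
        sc * ∫ x, |f x - fstar x| ∂P.fst := by
      simp only [localize, abs_mul]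
      rw [integral_const_mul, ← hν, ← hsc, abs_of_pos hscpos]
    rw [h1, h2, ← mul_sub, abs_mul, abs_of_pos hscpos, hsc, max_eq_right h, div_mul_eq_mul_div,
      div_lt_iff₀ hνpos] at hQ'
    have h3 : |A - ∫ x, |f x - fstar x| ∂P.fst| < (8 * L ^ 2)⁻¹ * ν := by
      have : r * |A - ∫ x, |f x - fstar x| ∂P.fst| < r * ((8 * L ^ 2)⁻¹ * ν) := by linarith
      exact lt_of_mul_lt_mul_left this hr.le
    -- The expectation of `|f - fstar|` is at least `ν / (4L²)`, and the deviation takes away less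
    -- than half of that.
    have h4 : (8 * L ^ 2)⁻¹ * ν ≤ A := by
      have h5 : (4 * L ^ 2)⁻¹ * ν ≤ ∫ x, |f x - fstar x| ∂P.fst := by
        rwa [inv_mul_le_iff₀ (by positivity)]
      have h6 : (4 * L ^ 2)⁻¹ * ν = 2 * ((8 * L ^ 2)⁻¹ * ν) := by field_simp; norm_num
      have := (abs_lt.1 h3).1
      linarith
    have h7 : A ^ 2 ≤ Q := sq_blockMean_abs_le hm e (fun x => f x - fstar x) (fun i => (D i).1) j
    -- The value of `α` comes from here: `Q ≥ 8αν²` outweighs the multiplier loss of at most `2αν²`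
    -- and leaves `6αν²`.
    have h8 : ((8 * L ^ 2)⁻¹ * ν) ^ 2 = 8 * α * ν ^ 2 := by rw [hα]; field_simp; norm_num
    have h9 : 8 * α * ν ^ 2 ≤ Q := by
      rw [← h8]
      exact (pow_le_pow_left₀ (by positivity) h4 2).trans h7
    have h10 : α * r * ν ≤ α * ν ^ 2 := by nlinarith [mul_pos hαpos hνpos]
    have h11 : α * r ^ 2 ≤ α * ν ^ 2 := by gcongr
    linarith

/-- The deterministic part of the analysis of the median-of-means procedure. -/
theorem medianCriterion_analysis {X : Type*} [MeasurableSpace X] {P : Measure (X × ℝ)}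
    {F : Set (X → ℝ)} {fstar : X → ℝ} {L r α : ℝ} (hL : 0 < L) (hr : 0 < r)
    (hα : α = (512 * L ^ 4)⁻¹)
    {N n m : ℕ} (hn : 0 < n) (hm : 0 < m) (e : Fin n × Fin m ↪ Fin N) (D : Fin N → X × ℝ)
    (hfstar : fstar ∈ F)
    (hE : ∀ f ∈ F, 0 ≤ ∫ z, (f z.1 - fstar z.1) * (fstar z.1 - z.2) ∂P)
    (hL1 : ∀ f ∈ F, l2Radius P.fst fstar f ≤ 4 * L ^ 2 * ∫ x, |f x - fstar x| ∂P.fst)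
    (hM : ∀ f ∈ F, ∑ j, min 1 (|blockMean e
      (fun z : X × ℝ => localize P.fst fstar r f z.1 * (fstar z.1 - z.2)) D j -
      ∫ z, localize P.fst fstar r f z.1 * (fstar z.1 - z.2) ∂P| / (α * r ^ 2)) ≤ (n : ℝ) / 8)
    (hQ : ∀ f ∈ F, r ≤ l2Radius P.fst fstar f → ∑ j, min 1 (|blockMean e
      (fun x => |localize P.fst fstar r f x|) (fun i => (D i).1) j -
      ∫ x, |localize P.fst fstar r f x| ∂P.fst| / ((8 * L ^ 2)⁻¹ * r)) ≤ (n : ℝ) / 8) :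
    MedianCriterion F e (2 * α * r ^ 2) D fstar ∧
    ∀ f ∈ F, MedianCriterion F e (2 * α * r ^ 2) D f →
      l2Radius P.fst fstar f ≤ r ∧
      2 * ∫ z, (f z.1 - fstar z.1) * (fstar z.1 - z.2) ∂P ≤ 4 * α * r ^ 2 := by
  have hαpos : 0 < α := by rw [hα]; positivity
  have hn' : (0 : ℝ) < n := by exact_mod_cast hn
  -- Each of the two deviations spoils at most one eighth of the blocks.
  have hgood : ∀ f ∈ F, ∃ S : Finset (Fin n), (3 / 4 : ℝ) * n ≤ S.card ∧ ∀ j ∈ S,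
      (l2Radius P.fst fstar f < r →
        2 * (∫ z, (f z.1 - fstar z.1) * (fstar z.1 - z.2) ∂P) - 2 * α * r ^ 2 ≤
        blockMean e (fun z : X × ℝ => (f z.1 - z.2) ^ 2 - (fstar z.1 - z.2) ^ 2) D j) ∧
      (r ≤ l2Radius P.fst fstar f → 6 * α * r ^ 2 ≤
        blockMean e (fun z : X × ℝ => (f z.1 - z.2) ^ 2 - (fstar z.1 - z.2) ^ 2) D j) := by
    intro f hf
    have h1 := card_le_of_sum_min_le _ _ _ (by positivity) (fun _ => abs_nonneg _) (hM f hf)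
    set B1 := Finset.univ.filter fun j => α * r ^ 2 ≤ |blockMean e
      (fun z : X × ℝ => localize P.fst fstar r f z.1 * (fstar z.1 - z.2)) D j -
      ∫ z, localize P.fst fstar r f z.1 * (fstar z.1 - z.2) ∂P| with hB1
    obtain ⟨B2, hB2c, hB2⟩ : ∃ B2 : Finset (Fin n), (B2.card : ℝ) ≤ n / 8 ∧ ∀ j ∉ B2,
        r ≤ l2Radius P.fst fstar f → |blockMean e
          (fun x => |localize P.fst fstar r f x|) (fun i => (D i).1) j -
          ∫ x, |localize P.fst fstar r f x| ∂P.fst| < (8 * L ^ 2)⁻¹ * r := by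
      by_cases hrad : r ≤ l2Radius P.fst fstar f
      · refine ⟨_, card_le_of_sum_min_le _ _ _ (by positivity) (fun _ => abs_nonneg _)
          (hQ f hf hrad), fun j hj _ => ?_⟩
        simpa using hj
      · exact ⟨∅, by simp; positivity, fun _ _ h => absurd h hrad⟩
    refine ⟨(B1 ∪ B2)ᶜ, ?_, fun j hj => ?_⟩
    · have h2 : ((B1 ∪ B2)ᶜ.card : ℝ) = n - (B1 ∪ B2).card := by
        rw [Finset.card_compl, Nat.cast_sub (by simpa using Finset.card_le_univ (B1 ∪ B2))]
        simp
      have h3 : ((B1 ∪ B2).card : ℝ) ≤ B1.card + B2.card := by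
        exact_mod_cast Finset.card_union_le B1 B2
      rw [h2]; linarith
    · simp only [Finset.mem_compl, Finset.mem_union, not_or] at hj
      exact excess_lower_bound hL hr hα hm e D j (hE f hf) (hL1 f hf)
        (by simpa [hB1] using hj.1) (hB2 j hj.2)
  refine ⟨fun h hh => ?_, fun f hf hcrit => ?_⟩
  · obtain ⟨S, hSc, hS⟩ := hgood h hh
    have hsub : S ⊆ Finset.univ.filter fun j => blockMean e
        (fun z : X × ℝ => (fstar z.1 - z.2) ^ 2 - (h z.1 - z.2) ^ 2) D j ≤ 2 * α * r ^ 2 := by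
      intro j hj
      simp only [Finset.mem_filter, Finset.mem_univ, true_and]
      -- The excess of `fstar` over `h` is the opposite of that of `h` over `fstar`, which is at
      -- least `-2αr²` on good blocks whether `h` is near or far.
      rw [blockMean_neg]
      have hpos : 0 < α * r ^ 2 := by positivity
      rcases lt_or_ge (l2Radius P.fst fstar h) r with hlt | hge
      · linarith [(hS j hj).1 hlt, hE h hh]
      · linarith [(hS j hj).2 hge]
    have h1 := Finset.card_le_card hsub
    have h2 : ((n : ℕ) : ℝ) ≤ 2 * S.card := by linarith
    have h3 : n ≤ 2 * S.card := by exact_mod_cast h2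
    omega
  · obtain ⟨S, hSc, hS⟩ := hgood f hf
    have hc := hcrit fstar hfstar
    set T := Finset.univ.filter fun j => blockMean e
      (fun z : X × ℝ => (f z.1 - z.2) ^ 2 - (fstar z.1 - z.2) ^ 2) D j ≤ 2 * α * r ^ 2 with hT
    -- Three quarters of the blocks are good and at least half accept `f` against `fstar`, so some
    -- block does both.
    obtain ⟨j, hj⟩ : (S ∩ T).Nonempty := by
      rw [← Finset.card_pos]
      have h1 := Finset.card_union_add_card_inter S T
      have h2 : (S ∪ T).card ≤ n := by simpa using Finset.card_le_univ (S ∪ T)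
      have h3 : (n : ℝ) ≤ 2 * T.card := by exact_mod_cast hc
      have h4 : ((S ∪ T).card : ℝ) ≤ n := by exact_mod_cast h2
      have h5 : ((S ∪ T).card : ℝ) + (S ∩ T).card = S.card + T.card := by exact_mod_cast h1
      have : (0 : ℝ) < (S ∩ T).card := by linarith
      exact_mod_cast this
    rw [Finset.mem_inter] at hj
    have hjT : blockMean e
        (fun z : X × ℝ => (f z.1 - z.2) ^ 2 - (fstar z.1 - z.2) ^ 2) D j ≤ 2 * α * r ^ 2 := by
      simpa [hT] using hj.2
    have hpos : 0 < α * r ^ 2 := by positivity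
    rcases lt_or_ge (l2Radius P.fst fstar f) r with hlt | hge
    · exact ⟨hlt.le, by linarith [(hS j hj.1).1 hlt]⟩
    -- The far case is contradictory: the excess would be both at least `6αr²` and at most `2αr²`.
    · linarith [(hS j hj.1).2 hge]

/-! ### Consequences of the learning assumption -/

theorem measurePreserving_fst_self {X : Type*} [MeasurableSpace X] (P : Measure (X × ℝ)) :
    MeasurePreserving Prod.fst P P.fst := ⟨measurable_fst, rfl⟩

theorem integral_comp_fst {X : Type*} [MeasurableSpace X] {P : Measure (X × ℝ)} {g : X → ℝ}
    (hg : AEStronglyMeasurable g P.fst) : ∫ z, g z.1 ∂P = ∫ x, g x ∂P.fst :=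
  (integral_map measurable_fst.aemeasurable hg).symm

theorem measurePreserving_pi_fst {X : Type*} [MeasurableSpace X] (P : Measure (X × ℝ))
    [IsProbabilityMeasure P] (N : ℕ) :
    MeasurePreserving (fun (D : Fin N → X × ℝ) i => (D i).1) (Measure.pi fun _ => P)
      (Measure.pi fun _ => P.fst) :=
  measurePreserving_pi (fun _ => P) (fun _ => P.fst) fun _ => measurePreserving_fst_self P

theorem integral_sq_add_mul {Ω : Type*} [MeasurableSpace Ω] {μ : Measure Ω} {u w : Ω → ℝ}
    (hu : MemLp u 2 μ) (hw : MemLp w 2 μ) (t : ℝ) :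
    ∫ x, (w x + t * u x) ^ 2 ∂μ =
      ∫ x, w x ^ 2 ∂μ + 2 * t * ∫ x, u x * w x ∂μ + t ^ 2 * ∫ x, u x ^ 2 ∂μ := by
  have huw : Integrable (fun x => u x * w x) μ := hu.integrable_mul hw
  have e : Integrable (fun x => w x ^ 2 + 2 * t * (u x * w x)) μ :=
    hw.integrable_sq.add (huw.const_mul _)
  rw [← integral_const_mul, ← integral_const_mul,
    ← integral_add hw.integrable_sq (huw.const_mul _),
    ← integral_add e (hu.integrable_sq.const_mul _)]
  congr 1; ext x; ring

namespace LearningAssumption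

variable {X : Type*} [MeasurableSpace X] {P : Measure (X × ℝ)}
  {F : Set (X → ℝ)} {fstar : X → ℝ} {L σ : ℝ}

theorem memLp_sub (H : LearningAssumption P F fstar L σ) {f h : X → ℝ} (hf : f ∈ F)
    (hh : h ∈ F) : MemLp (fun x => f x - h x) 2 P.fst :=
  (H.memLp_class f hf).sub (H.memLp_class h hh)

theorem memLp_noise (H : LearningAssumption P F fstar L σ) :
    MemLp (fun z : X × ℝ => fstar z.1 - z.2) 2 P :=
  ((H.memLp_class fstar H.minimizer.1).comp_measurePreserving
    (measurePreserving_fst_self P)).sub H.memLp_target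

theorem integral_sq_localize_le {r : ℝ} (hr : 0 < r) {f : X → ℝ} :
    ∫ x, localize P.fst fstar r f x ^ 2 ∂P.fst ≤ r ^ 2 := by
  simp only [localize, mul_pow, integral_const_mul]
  rw [← sq_l2Radius, ← mul_pow]
  have h := l2Radius_nonneg P.fst fstar f
  refine pow_le_pow_left₀ (by positivity) ?_ 2
  rw [div_mul_eq_mul_div, div_le_iff₀ (lt_max_of_lt_left hr)]
  gcongr
  exact le_max_right _ _

theorem fourth_moment (H : LearningAssumption P F fstar L σ) (hL : 0 ≤ L) {f h : X → ℝ}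
    (hf : f ∈ F) (hh : h ∈ F) : Integrable (fun x => (f x - h x) ^ 4) P.fst ∧
      ∫ x, (f x - h x) ^ 4 ∂P.fst ≤ L ^ 4 * (∫ x, (f x - h x) ^ 2 ∂P.fst) ^ 2 :=
  integral_pow_four_le (H.memLp_sub hf hh) hL (H.norm_equiv_class f hf h hh)

theorem noise_fourth_moment (H : LearningAssumption P F fstar L σ) (hL : 0 ≤ L) (hσ : 0 < σ) :
    Integrable (fun z : X × ℝ => (fstar z.1 - z.2) ^ 4) P ∧
      ∫ z, (fstar z.1 - z.2) ^ 4 ∂P ≤ L ^ 4 * σ ^ 4 := by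
  obtain ⟨h1, h2⟩ := integral_pow_four_le H.memLp_noise hL
    (H.norm_equiv_target fstar H.minimizer.1)
  refine ⟨h1, h2.trans ?_⟩
  have h3 := H.noise_level
  rw [eLpNorm_two_eq_ofReal_sqrt H.memLp_noise, ENNReal.ofReal_le_ofReal_iff hσ.le] at h3
  have h4 : ∫ z, (fstar z.1 - z.2) ^ 2 ∂P ≤ σ ^ 2 := (Real.sqrt_le_left hσ.le).1 h3
  have h5 : 0 ≤ ∫ z, (fstar z.1 - z.2) ^ 2 ∂P := integral_nonneg fun _ => sq_nonneg _
  have h6 : (∫ z, (fstar z.1 - z.2) ^ 2 ∂P) ^ 2 ≤ (σ ^ 2) ^ 2 := by gcongr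
  calc L ^ 4 * (∫ z, (fstar z.1 - z.2) ^ 2 ∂P) ^ 2 ≤ L ^ 4 * (σ ^ 2) ^ 2 := by gcongr
    _ = L ^ 4 * σ ^ 4 := by ring

theorem memLp_sub_fst (H : LearningAssumption P F fstar L σ) {f : X → ℝ} (hf : f ∈ F) :
    MemLp (fun z : X × ℝ => f z.1 - fstar z.1) 2 P :=
  (H.memLp_sub hf H.minimizer.1).comp_measurePreserving (measurePreserving_fst_self P)

theorem integral_sq_sub_fst (H : LearningAssumption P F fstar L σ) {f : X → ℝ} (hf : f ∈ F) :
    ∫ z, (f z.1 - fstar z.1) ^ 2 ∂P = l2Radius P.fst fstar f ^ 2 := by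
  rw [sq_l2Radius]
  exact integral_comp_fst (g := fun x => (f x - fstar x) ^ 2)
    ((H.memLp_sub hf H.minimizer.1).aestronglyMeasurable.pow 2)

theorem risk_eq (H : LearningAssumption P F fstar L σ) {f : X → ℝ} (hf : f ∈ F) :
    ∫ z, (f z.1 - z.2) ^ 2 ∂P = ∫ z, (fstar z.1 - z.2) ^ 2 ∂P +
      2 * ∫ z, (f z.1 - fstar z.1) * (fstar z.1 - z.2) ∂P + l2Radius P.fst fstar f ^ 2 := by
  have h := integral_sq_add_mul (H.memLp_sub_fst hf) H.memLp_noise 1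
  rw [H.integral_sq_sub_fst hf] at h
  simp only [mul_one, one_pow, one_mul] at h
  rw [← h]
  congr 1; ext z; ring

/-- First-order optimality: by convexity the segment from `fstar` to `f` stays in `F`, and along it
the risk, a quadratic polynomial in `t`, cannot fall below its value at 0. -/
theorem integral_mul_noise_nonneg (H : LearningAssumption P F fstar L σ) {f : X → ℝ}
    (hf : f ∈ F) : 0 ≤ ∫ z, (f z.1 - fstar z.1) * (fstar z.1 - z.2) ∂P := by
  set E := ∫ z, (f z.1 - fstar z.1) * (fstar z.1 - z.2) ∂P with hE
  have key (t : ℝ) (ht : 0 < t) (ht1 : t ≤ 1) : 0 ≤ 2 * E + t * l2Radius P.fst fstar f ^ 2 := by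
    have hmem : (1 - t) • fstar + t • f ∈ F :=
      H.convex H.minimizer.1 hf (by linarith) ht.le (by ring)
    have h1 := H.minimizer.2 _ hmem
    have h2 := integral_sq_add_mul (H.memLp_sub_fst hf) H.memLp_noise t
    rw [H.integral_sq_sub_fst hf] at h2
    have h3 : ∫ z, (((1 - t) • fstar + t • f) z.1 - z.2) ^ 2 ∂P =
        ∫ z, ((fstar z.1 - z.2) + t * (f z.1 - fstar z.1)) ^ 2 ∂P := by
      congr 1; ext z
      simp only [Pi.add_apply, Pi.smul_apply, smul_eq_mul]
      ring
    rw [h3, h2] at h1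
    have h4 : 0 ≤ t * (2 * E + t * l2Radius P.fst fstar f ^ 2) := by linarith
    exact nonneg_of_mul_nonneg_right h4 ht
  by_contra hneg
  push Not at hneg
  set Q := l2Radius P.fst fstar f ^ 2
  have hQ : 0 ≤ Q := sq_nonneg _
  have h1 := key (min 1 (-E / (Q + 1))) (lt_min one_pos (div_pos (by linarith) (by linarith)))
    (min_le_left _ _)
  have h2 : min 1 (-E / (Q + 1)) * Q ≤ -E / (Q + 1) * Q :=
    mul_le_mul_of_nonneg_right (min_le_right _ _) hQ
  have h3 : -E / (Q + 1) * Q ≤ -E := by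
    rw [div_mul_eq_mul_div, div_le_iff₀ (by linarith)]
    nlinarith
  linarith

theorem l2Radius_le_integral_abs [IsProbabilityMeasure P]
    (H : LearningAssumption P F fstar L σ) (hL : 0 < L)
    {f : X → ℝ} (hf : f ∈ F) :
    l2Radius P.fst fstar f ≤ 4 * L ^ 2 * ∫ x, |f x - fstar x| ∂P.fst := by
  obtain ⟨h1, h2⟩ := H.fourth_moment hL.le hf H.minimizer.1
  exact sqrt_integral_sq_le_integral_abs (H.memLp_sub hf H.minimizer.1) hL h1 h2

/-- A countable subclass approximates the class both pointwise and in `L₂`. -/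
theorem exists_approximation [IsProbabilityMeasure P]
    (H : LearningAssumption P F fstar L σ) (hL : 0 < L) :
    ∃ (q : ℕ → F) (S : Set X), P.fst S = 0 ∧ ∀ f : F, ∃ s : ℕ → ℕ,
      (∀ x, x ∉ S → Tendsto (fun k => (q (s k)).1 x) atTop (𝓝 (f.1 x))) ∧
      Tendsto (fun k => √(∫ x, ((q (s k)).1 x - f.1 x) ^ 2 ∂P.fst)) atTop (𝓝 0) := by
  obtain ⟨F₀, hF₀, hcount, S, hS, happ⟩ := H.measurableClass
  obtain ⟨s₀, hs₀, -⟩ := happ fstar H.minimizer.1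
  obtain ⟨q, hq⟩ := hcount.exists_eq_range ⟨s₀ 0, hs₀ 0⟩
  have hqF (k : ℕ) : q k ∈ F := hF₀ (hq ▸ Set.mem_range_self k)
  refine ⟨fun k => ⟨q k, hqF k⟩, S, hS, fun f => ?_⟩
  obtain ⟨s', hs', hlim⟩ := happ f.1 f.2
  have hidx (k : ℕ) : ∃ i, q i = s' k := by
    have := hs' k
    rwa [hq] at this
  choose s hs using hidx
  refine ⟨s, fun x hx => by simpa only [hs] using hlim x hx, ?_⟩
  refine tendsto_sqrt_integral_sq_of_ae (d := fun k x => q (s k) x - f.1 x)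
    (fun k => H.memLp_sub (hqF _) f.2) hL (fun k => (H.fourth_moment hL.le (hqF _) f.2).1)
    (fun k => (H.fourth_moment hL.le (hqF _) f.2).2) ?_
  filter_upwards [measure_eq_zero_iff_ae_notMem.1 hS] with x hx
  have := (hlim x hx).sub_const (f.1 x)
  simpa [hs] using this

theorem tendsto_localize_factor (H : LearningAssumption P F fstar L σ) {r : ℝ} (hr : 0 < r)
    (g : ℕ → F) (f : F)
    (h : Tendsto (fun k => √(∫ x, ((g k).1 x - f.1 x) ^ 2 ∂P.fst)) atTop (𝓝 0)) :
    Tendsto (fun k => r / max r (l2Radius P.fst fstar (g k).1)) atTop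
      (𝓝 (r / max r (l2Radius P.fst fstar f.1))) := by
  refine tendsto_const_nhds.div (tendsto_const_nhds.max ?_) (lt_max_of_lt_left hr).ne'
  refine (Real.continuous_sqrt.tendsto _).comp (tendsto_integral_sq_of_sq
    (fun k => H.memLp_sub (g k).2 H.minimizer.1) (H.memLp_sub f.2 H.minimizer.1) ?_)
  simpa using h

theorem tendsto_integral_abs_localize [IsProbabilityMeasure P]
    (H : LearningAssumption P F fstar L σ) {r : ℝ} (hr : 0 < r)
    (g : ℕ → F) (f : F)
    (h : Tendsto (fun k => √(∫ x, ((g k).1 x - f.1 x) ^ 2 ∂P.fst)) atTop (𝓝 0)) :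
    Tendsto (fun k => ∫ x, |localize P.fst fstar r (g k).1 x| ∂P.fst) atTop
      (𝓝 (∫ x, |localize P.fst fstar r f.1 x| ∂P.fst)) := by
  simp only [localize, abs_mul, integral_const_mul]
  refine (H.tendsto_localize_factor hr g f h).abs.mul ?_
  refine tendsto_integral_abs_of_sq (fun k => H.memLp_sub (g k).2 H.minimizer.1)
    (H.memLp_sub f.2 H.minimizer.1) ?_
  simpa using h

theorem tendsto_integral_localize_mul_noise (H : LearningAssumption P F fstar L σ) {r : ℝ}
    (hr : 0 < r) (g : ℕ → F) (f : F)
    (h : Tendsto (fun k => √(∫ x, ((g k).1 x - f.1 x) ^ 2 ∂P.fst)) atTop (𝓝 0)) :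
    Tendsto (fun k => ∫ z, localize P.fst fstar r (g k).1 z.1 * (fstar z.1 - z.2) ∂P) atTop
      (𝓝 (∫ z, localize P.fst fstar r f.1 z.1 * (fstar z.1 - z.2) ∂P)) := by
  simp only [localize, mul_assoc, integral_const_mul]
  refine (H.tendsto_localize_factor hr g f h).mul ?_
  refine tendsto_integral_mul_of_sq (fun k => H.memLp_sub_fst (g k).2)
    (H.memLp_sub_fst f.2) H.memLp_noise ?_
  refine h.congr fun k => ?_
  rw [← integral_comp_fst (g := fun x => ((g k).1 x - f.1 x) ^ 2)
    ((H.memLp_sub (g k).2 f.2).aestronglyMeasurable.pow 2)]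
  simp

theorem memLp_localize (H : LearningAssumption P F fstar L σ) (r : ℝ) {f : X → ℝ} (hf : f ∈ F) :
    MemLp (localize P.fst fstar r f) 2 P.fst :=
  (H.memLp_sub hf H.minimizer.1).const_mul _

theorem fourth_moment_localize (H : LearningAssumption P F fstar L σ) (hL : 0 ≤ L) {r : ℝ}
    (hr : 0 < r) {f : X → ℝ} (hf : f ∈ F) :
    Integrable (fun x => localize P.fst fstar r f x ^ 4) P.fst ∧
      ∫ x, localize P.fst fstar r f x ^ 4 ∂P.fst ≤ L ^ 4 * r ^ 4 := by
  obtain ⟨h1, h2⟩ := H.fourth_moment hL hf H.minimizer.1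
  have hsq := integral_sq_localize_le (P := P) (fstar := fstar) hr (f := f)
  simp only [localize, mul_pow, integral_const_mul] at hsq ⊢
  refine ⟨h1.const_mul _, ?_⟩
  set sc := r / max r (l2Radius P.fst fstar f)
  have h0 : 0 ≤ sc ^ 2 * ∫ x, (f x - fstar x) ^ 2 ∂P.fst :=
    mul_nonneg (sq_nonneg _) (integral_nonneg fun _ => sq_nonneg _)
  calc sc ^ 4 * ∫ x, (f x - fstar x) ^ 4 ∂P.fst
      ≤ sc ^ 4 * (L ^ 4 * (∫ x, (f x - fstar x) ^ 2 ∂P.fst) ^ 2) := by gcongr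
    _ = L ^ 4 * (sc ^ 2 * ∫ x, (f x - fstar x) ^ 2 ∂P.fst) ^ 2 := by ring
    _ ≤ L ^ 4 * (r ^ 2) ^ 2 := by gcongr
    _ = L ^ 4 * r ^ 4 := by ring

theorem localize_mul_noise (H : LearningAssumption P F fstar L σ) (hL : 0 ≤ L) (hσ : 0 < σ)
    {r : ℝ} (hr : 0 < r) {f : X → ℝ} (hf : f ∈ F) :
    MemLp (fun z : X × ℝ => localize P.fst fstar r f z.1 * (fstar z.1 - z.2)) 2 P ∧
      ∫ z, (localize P.fst fstar r f z.1 * (fstar z.1 - z.2)) ^ 2 ∂P ≤ L ^ 4 * r ^ 2 * σ ^ 2 := by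
  obtain ⟨h1, h2⟩ := H.fourth_moment_localize hL hr hf
  obtain ⟨h3, h4⟩ := H.noise_fourth_moment hL hσ
  have hfst := measurePreserving_fst_self P
  refine integral_sq_mul_sq_le (u := fun z : X × ℝ => localize P.fst fstar r f z.1) hr hσ
    ((H.memLp_localize r hf).comp_measurePreserving hfst).aestronglyMeasurable
    H.memLp_noise.aestronglyMeasurable (hfst.integrable_comp_of_integrable h1) h3 ?_ h4
  refine le_trans (le_of_eq ?_) h2
  exact integral_comp_fst (g := fun x => localize P.fst fstar r f x ^ 4)
    ((H.memLp_localize r hf).aestronglyMeasurable.pow 4)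

/-- The conditions defining the complexity parameters are available at some `ρ < r`, not at `r`
itself. Star-shapedness brings functions localized at `r` down to radius `ρ`. -/
theorem smul_localize_mem (H : LearningAssumption P F fstar L σ) {ρ r : ℝ} (hρ : 0 < ρ)
    (hρr : ρ ≤ r) {f : X → ℝ} (hf : f ∈ F) :
    (fun x => ρ / r * localize P.fst fstar r f x) ∈ localization P.fst F fstar ρ := by
  have hr : 0 < r := hρ.trans_le hρr
  have hmax : 0 < max r (l2Radius P.fst fstar f) := lt_max_of_lt_left hr
  refine ⟨⟨f - fstar, ⟨f, hf, rfl⟩, ρ / r * (r / max r (l2Radius P.fst fstar f)), by positivity,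
    ?_, ?_⟩, ?_⟩
  · refine mul_le_one₀ ((div_le_one hr).2 hρr) (by positivity) ((div_le_one hmax).2 (le_max_left _ _))
  · ext x
    simp [localize, mul_assoc]
  · have hL : MemLp (fun x => ρ / r * localize P.fst fstar r f x) 2 P.fst :=
      (H.memLp_localize r hf).const_mul _
    change eLpNorm (fun x => ρ / r * localize P.fst fstar r f x) 2 P.fst ≤ ENNReal.ofReal ρ
    rw [eLpNorm_two_eq_ofReal_sqrt hL]
    refine ENNReal.ofReal_le_ofReal ((Real.sqrt_le_left hρ.le).2 ?_)
    simp only [mul_pow, integral_const_mul]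
    calc (ρ / r) ^ 2 * ∫ x, localize P.fst fstar r f x ^ 2 ∂P.fst
        ≤ (ρ / r) ^ 2 * r ^ 2 := by
          gcongr
          exact integral_sq_localize_le hr
      _ = ρ ^ 2 := by field_simp

end LearningAssumption

/-! ### Uniform deviations over the localized class -/

theorem exists_of_infRadius_lt {p : ℝ → Prop} {r : ℝ} (h : infRadius p < ENNReal.ofReal r) :
    ∃ ρ, 0 < ρ ∧ ρ < r ∧ p ρ := by
  unfold infRadius at h
  obtain ⟨ρ, hρ⟩ := iInf_lt_iff.1 h
  obtain ⟨⟨hpos, hp⟩, hlt⟩ := iInf_lt_iff.1 hρ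
  exact ⟨ρ, hpos, (ENNReal.ofReal_lt_ofReal_iff_of_nonneg hpos.le).1 hlt, hp⟩

theorem absRademacherAverage_const_mul {ι κ : Type*} [Fintype κ] [DecidableEq κ]
    (c : ℝ) (hc : 0 ≤ c) (t : ι → κ → ℝ) :
    absRademacherAverage (fun k i => c * t k i) = c * absRademacherAverage t := by
  unfold absRademacherAverage
  rw [mul_left_comm]
  congr 1
  rw [Finset.mul_sum]
  refine Finset.sum_congr rfl fun ε _ => ?_
  rw [Real.mul_iSup_of_nonneg hc]
  refine iSup_congr fun k => ?_
  rw [← abs_of_nonneg hc, ← abs_mul, Finset.mul_sum, abs_of_nonneg hc]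
  exact congrArg _ (Finset.sum_congr rfl fun i _ => by ring)

/-- A bound for the Rademacher averages of multiples of the functions of a class carries over to
the functions themselves. -/
theorem integral_absRademacherAverage_le_of_mul {ι Z : Type*} [Fintype ι] [Nonempty ι]
    [MeasurableSpace Z] (P : Measure Z) [IsProbabilityMeasure P] {N : ℕ} (hN : 0 < N)
    (G : Set (Z → ℝ)) (u g : ι → Z → ℝ) (hum : ∀ k, Measurable (u k))
    (hui : ∀ k, Integrable (u k) P) (c : ℝ) (hc : 0 < c)
    (hg : ∀ k, (fun z => c * g k z) ∈ G) (hug : ∀ k, u k =ᵐ[P] g k) (B : ℝ)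
    (hB : 0 ≤ B) (h : rademacherMean P N G ≤ ENNReal.ofReal (B * √(N : ℝ))) :
    ∫ z : Fin N → Z, absRademacherAverage (fun k i => u k (z i)) ∂(Measure.pi fun _ => P) ≤
      B * N / c := by
  have h1 := integral_absRademacherAverage_le P hN G (fun k z => c * u k z)
    (fun k z => c * g k z) (fun k => (hum k).const_mul c) (fun k => (hui k).const_mul c) hg
    (fun k => (hug k).mono fun z hz => congrArg (c * ·) hz) B hB h
  simp only [absRademacherAverage_const_mul _ hc.le, integral_const_mul] at h1
  rw [le_div_iff₀ hc]
  linarith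

namespace LearningAssumption

variable {X : Type*} [MeasurableSpace X] {P : Measure (X × ℝ)}
  {F : Set (X → ℝ)} {fstar : X → ℝ} {L σ : ℝ}

/-- Contraction passes from `|u|` to `u`, whose Rademacher averages are controlled by `rE`; the
second moment of `|u|` is at most `r²` by localization. -/
theorem measure_quadratic_deviation_le [IsProbabilityMeasure P]
    (H : LearningAssumption P F fstar L σ) (hL : 0 < L) {r c₁ : ℝ} (hr : 0 < r) (hc₁ : 0 < c₁) {N n m : ℕ} (hN : 0 < N) (hn : 0 < n) (hm : 0 < m)
    (e : Fin n × Fin m ↪ Fin N) (hE : rE P.fst F N c₁ fstar < ENNReal.ofReal r) (α : ℝ)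
    (hα : 0 < α) (hsmall : n * (√(r ^ 2 / m) / α) + 4 * (c₁ * r * N) / (m * α) ≤ n / 16) :
    (Measure.pi fun _ : Fin N => P) {D | ∃ f : F, (n : ℝ) / 8 < ∑ j, min 1 (|blockMean e
      (fun x => |localize P.fst fstar r f x|) (fun i => (D i).1) j -
      ∫ x, |localize P.fst fstar r f x| ∂P.fst| / α)} ≤
        ENNReal.ofReal (Real.exp (-(n : ℝ) / 512)) := by
  obtain ⟨q, S, hS, happ⟩ := H.exists_approximation hL
  obtain ⟨ρ, hρ, hρr, hρE⟩ := exists_of_infRadius_lt hE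
  have hae (k : ℕ) : AEMeasurable (localize P.fst fstar r (q k).1) P.fst :=
    (H.memLp_localize r (q k).2).aestronglyMeasurable.aemeasurable
  set u : ℕ → X → ℝ := fun k => (hae k).mk _ with hu
  have hum (k) : Measurable (u k) := (hae k).measurable_mk
  have huae (k) : u k =ᵐ[P.fst] localize P.fst fstar r (q k).1 := (hae k).ae_eq_mk.symm
  have huL (k) : MemLp (u k) 2 P.fst := (H.memLp_localize r (q k).2).ae_eq (huae k).symm
  have hui (k) : Integrable (u k) P.fst := (huL k).integrable (by norm_num)
  have huz (k : ℕ) (i : Fin N) :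
      Integrable (fun z : Fin N → X => u k (z i)) (Measure.pi fun _ => P.fst) :=
    integrable_comp_eval (μ := fun _ : Fin N => P.fst) (hui k)
  have huzm (k : ℕ) (i : Fin N) : Measurable (fun z : Fin N → X => u k (z i)) :=
    (hum k).comp (measurable_pi_apply i)
  have hR (K : ℕ) : ∫ z : Fin N → X, rademacherAverage (fun (k : Fin (K + 1)) i => |u k (z i)|)
      ∂(Measure.pi fun _ => P.fst) ≤ c₁ * r * N := by
    have h1 := integral_absRademacherAverage_le_of_mul P.fst hN
      (localization P.fst F fstar ρ) (fun k : Fin (K + 1) => u k)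
      (fun k => localize P.fst fstar r (q k).1) (fun k => hum k) (fun k => hui k) (ρ / r)
      (div_pos hρ hr) (fun k => H.smul_localize_mem hρ hρr.le (q k).2) (fun k => huae k) (c₁ * ρ)
      (by positivity) (by convert hρE using 2; ring)
    -- The bound is homogeneous of degree one, so it rescales exactly from `ρ` to `r`.
    have h2 : c₁ * ρ * N / (ρ / r) = c₁ * r * N := by field_simp
    rw [h2] at h1
    exact (integral_mono
      (integrable_rademacherAverage (fun (k : Fin (K + 1)) i => (huzm k i).abs)
        fun k i => (huz k i).abs)
      (integrable_absRademacherAverage (fun (k : Fin (K + 1)) i => huzm k i) fun k i => huz k i)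
      fun z => rademacherAverage_abs_le _).trans h1
  have hdev := measure_block_deviation P.fst hn hm e (fun k x => |u k x|) (fun k => (hum k).abs)
    (fun k => (huL k).abs) (r ^ 2) (c₁ * r * N) α (fun k => by
      simp only [sq_abs]
      rw [integral_congr_ae ((huae k).mono fun x hx => by
        show u k x ^ 2 = localize P.fst fstar r (q k).1 x ^ 2
        rw [hx])]
      exact integral_sq_localize_le hr) hα hR hsmall
  have hcls := measure_class_block_deviation_le P.fst e ((n : ℝ) / 8) α
    (fun (f : F) x => |localize P.fst fstar r f.1 x|) q (fun k x => |u k x|)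
    (fun k => (huae k).mono fun x hx => by simp only [hx]) S hS fun f => by
      obtain ⟨s, hs, hs2⟩ := happ f
      refine ⟨s, fun x hx => ?_, H.tendsto_integral_abs_localize hr (fun k => q (s k)) f hs2⟩
      exact ((H.tendsto_localize_factor hr (fun k => q (s k)) f hs2).mul
        ((hs x hx).sub_const _)).abs
  have hmp := measurePreserving_pi_fst P N
  refine le_trans ?_ (hcls.trans hdev)
  -- The event over the class need not be measurable, but the outer measure of its preimage is at
  -- most its measure under the image law.
  have h := Measure.le_map_apply (μ := Measure.pi fun _ : Fin N => P) hmp.measurable.aemeasurable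
    {z | ∃ f : F, (n : ℝ) / 8 < ∑ j, min 1 (|blockMean e
      (fun x => |localize P.fst fstar r f x|) z j -
      ∫ x, |localize P.fst fstar r f x| ∂P.fst| / α)}
  rw [hmp.map_eq] at h
  exact h

/-- The multiplier class is controlled by a sequence of measurable functions. -/
theorem exists_multiplier_sequence [IsProbabilityMeasure P]
    (H : LearningAssumption P F fstar L σ) (hL : 0 < L)
    (hσ : 0 < σ) {r c₁ : ℝ} (hr : 0 < r) (hc₁ : 0 < c₁) {N : ℕ} (hN : 0 < N)
    (hM : rMbar P F N c₁ fstar < ENNReal.ofReal r) :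
    ∃ u : ℕ → X × ℝ → ℝ, (∀ k, Measurable (u k)) ∧ (∀ k, MemLp (u k) 2 P) ∧
      (∀ k, ∫ z, u k z ^ 2 ∂P ≤ L ^ 4 * r ^ 2 * σ ^ 2) ∧
      (∀ K : ℕ, ∫ z : Fin N → X × ℝ, absRademacherAverage (fun (k : Fin (K + 1)) i => u k (z i))
        ∂(Measure.pi fun _ => P) ≤ c₁ * r ^ 2 * N) ∧
      ∀ (n m : ℕ) (e : Fin n × Fin m ↪ Fin N) (c α : ℝ),
        (Measure.pi fun _ : Fin N => P) {D | ∃ f : F, c < ∑ j, min 1 (|blockMean e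
          (fun z : X × ℝ => localize P.fst fstar r f z.1 * (fstar z.1 - z.2)) D j -
          ∫ z, localize P.fst fstar r f z.1 * (fstar z.1 - z.2) ∂P| / α)} ≤
        (Measure.pi fun _ : Fin N => P) {D | ∃ k, c <
          ∑ j, min 1 (|blockMean e (u k) D j - ∫ x, u k x ∂P| / α)} := by
  obtain ⟨q, S, hS, happ⟩ := H.exists_approximation hL
  obtain ⟨ρ, hρ, hρr, hρM⟩ := exists_of_infRadius_lt hM
  have hmem (k : ℕ) := H.localize_mul_noise hL.le hσ hr (q k).2
  have hae (k : ℕ) : AEMeasurable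
      (fun z : X × ℝ => localize P.fst fstar r (q k).1 z.1 * (fstar z.1 - z.2)) P :=
    (hmem k).1.aestronglyMeasurable.aemeasurable
  have huL (k) : MemLp ((hae k).mk _) 2 P := (hmem k).1.ae_eq (hae k).ae_eq_mk
  refine ⟨fun k => (hae k).mk _, fun k => (hae k).measurable_mk, huL, fun k => ?_, fun K => ?_,
    fun n m e c α => ?_⟩
  · refine le_trans (le_of_eq (integral_congr_ae ?_)) (hmem k).2
    exact (hae k).ae_eq_mk.symm.mono fun x hx => by simp only [hx]
  · have h1 := integral_absRademacherAverage_le_of_mul P hN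
      ((fun (u : X → ℝ) (z : X × ℝ) => u z.1 * (fstar z.1 - z.2)) ''
        localization P.fst F fstar ρ) (fun k : Fin (K + 1) => (hae k).mk _)
      (fun k z => localize P.fst fstar r (q k).1 z.1 * (fstar z.1 - z.2))
      (fun k => (hae k).measurable_mk) (fun k => (huL k).integrable (by norm_num)) (ρ / r)
      (div_pos hρ hr)
      (fun k => ⟨_, H.smul_localize_mem hρ hρr.le (q k).2, by ext z; simp only [mul_assoc]⟩)
      (fun k => (hae k).ae_eq_mk.symm) (c₁ * ρ ^ 2)
      (by positivity) (by convert hρM using 2; ring)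
    refine h1.trans ?_
    -- Rescaling a bound of order `ρ²` gives `ρ r`, which is at most `r²`.
    have h2 : c₁ * ρ ^ 2 * N / (ρ / r) = c₁ * (ρ * r) * N := by field_simp
    rw [h2, pow_two]
    gcongr
  · refine measure_class_block_deviation_le P e c α
      (fun (f : F) (z : X × ℝ) => localize P.fst fstar r f.1 z.1 * (fstar z.1 - z.2)) q _
      (fun k => (hae k).ae_eq_mk.symm) (Prod.fst ⁻¹' S)
      (le_antisymm ((Measure.le_map_apply measurable_fst.aemeasurable S).trans hS.le) zero_le)
      fun f => ?_
    obtain ⟨s, hs, hs2⟩ := happ f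
    refine ⟨s, fun z hz => ?_,
      H.tendsto_integral_localize_mul_noise hr (fun k => q (s k)) f hs2⟩
    exact ((H.tendsto_localize_factor hr (fun k => q (s k)) f hs2).mul
      ((hs z.1 hz).sub_const _)).mul_const _

/-- If the localized class contains no two separated points, it has a small radius. -/
theorem l2Radius_lt_of_packing (H : LearningAssumption P F fstar L σ) {ρ r η x : ℝ}
    (hρ : 0 < ρ) (hρr : ρ < r) (hη : η ≤ 1) (hx : x ≤ 1 / 2)
    (h : ENNReal.log (l2PackingNumber P.fst (localization P.fst F fstar ρ) (η * ρ) : ℝ≥0∞) ≤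
      (x : EReal)) {f : X → ℝ} (hf : f ∈ F) : l2Radius P.fst fstar f < r := by
  by_contra hge
  push Not at hge
  have hr : 0 < r := hρ.trans hρr
  set v : X → ℝ := fun x => ρ / r * localize P.fst fstar r f x with hv
  have hvmem : v ∈ localization P.fst F fstar ρ := H.smul_localize_mem hρ hρr.le hf
  have hvL : MemLp v 2 P.fst := (H.memLp_localize r hf).const_mul _
  have hvn : eLpNorm v 2 P.fst = ENNReal.ofReal ρ := by
    rw [eLpNorm_two_eq_ofReal_sqrt hvL]
    congr 1
    have hν : 0 < l2Radius P.fst fstar f := hr.trans_le hge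
    have : ∫ x, v x ^ 2 ∂P.fst = ρ ^ 2 := by
      simp only [hv, localize, max_eq_right hge, mul_pow, integral_const_mul]
      rw [← sq_l2Radius]
      field_simp
    rw [this, Real.sqrt_sq hρ.le]
  have hzero : (0 : X → ℝ) ∈ localization P.fst F fstar ρ :=
    ⟨⟨f - fstar, ⟨f, hf, rfl⟩, 0, le_rfl, zero_le_one, by simp⟩, by simp⟩
  have hv0 : v ≠ 0 := by
    intro h0
    rw [h0] at hvn
    simp at hvn
    linarith
  have hle : ENNReal.ofReal (η * ρ) ≤ ENNReal.ofReal ρ :=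
    ENNReal.ofReal_le_ofReal (mul_le_of_le_one_left hρ.le hη)
  -- A function at distance at least `r` from `fstar` yields `v` of norm exactly `ρ`, so `0` and `v`
  -- are separated by `ηρ`; but `log 2 > 1/2`.
  have hcard : (2 : ℕ∞) ≤ l2PackingNumber P.fst (localization P.fst F fstar ρ) (η * ρ) := by
    classical
    refine le_iSup₂_of_le ({0, v} : Finset (X → ℝ)) ⟨?_, ?_⟩ ?_
    · intro a ha
      simp only [Finset.coe_insert, Finset.coe_singleton, Set.mem_insert_iff,
        Set.mem_singleton_iff] at ha
      rcases ha with rfl | rfl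
      exacts [hzero, hvmem]
    · simp only [Finset.coe_insert, Finset.coe_singleton]
      rw [Set.pairwise_pair]
      intro _
      rw [zero_sub, eLpNorm_neg, sub_zero, hvn]
      exact ⟨hle, hle⟩
    · rw [Finset.card_pair hv0.symm]; rfl
  have h2 : (ENNReal.ofReal 2) ≤
      (l2PackingNumber P.fst (localization P.fst F fstar ρ) (η * ρ) : ℝ≥0∞) := by
    have := ENat.toENNReal_le.2 hcard
    simpa using this
  have h3 := (ENNReal.log_le_log_iff.2 h2).trans h
  rw [ENNReal.log_ofReal_of_pos (by norm_num), EReal.coe_le_coe_iff] at h3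
  have := Real.log_two_gt_d9
  linarith

end LearningAssumption

/-! ### The procedure and its probability of failure -/

/-- The median-of-means procedure succeeds unless one of two uniform deviations is large. -/
theorem exists_medianOfMeans_procedure {X : Type*} [MeasurableSpace X] {F : Set (X → ℝ)}
    (hF : F.Nonempty) {L r : ℝ} (hL : 1 ≤ L) (hr : 0 < r) {N n m : ℕ} (hn : 0 < n) (hm : 0 < m)
    (e : Fin n × Fin m ↪ Fin N) (σ : ℝ) :
    ∃ Φ : (Fin N → X × ℝ) → F, ∀ (P : Measure (X × ℝ)) [IsProbabilityMeasure P]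
      (fstar : X → ℝ), LearningAssumption P F fstar L σ →
      {D | eLpNorm ((Φ D : X → ℝ) - fstar) 2 P.fst ≤ ENNReal.ofReal (2 * r) ∧
        ∫ z, ((Φ D : X → ℝ) z.1 - z.2) ^ 2 ∂P ≤
          ∫ z, (fstar z.1 - z.2) ^ 2 ∂P + (2 * r) ^ 2}ᶜ ⊆
      {D | ∃ f : F, (n : ℝ) / 8 < ∑ j, min 1 (|blockMean e
          (fun z : X × ℝ => localize P.fst fstar r f z.1 * (fstar z.1 - z.2)) D j -
          ∫ z, localize P.fst fstar r f z.1 * (fstar z.1 - z.2) ∂P| /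
            ((512 * L ^ 4)⁻¹ * r ^ 2))} ∪
      {D | ∃ f : F, r ≤ l2Radius P.fst fstar f ∧ (n : ℝ) / 8 < ∑ j, min 1 (|blockMean e
          (fun x => |localize P.fst fstar r f x|) (fun i => (D i).1) j -
          ∫ x, |localize P.fst fstar r f x| ∂P.fst| / ((8 * L ^ 2)⁻¹ * r))} := by
  classical
  obtain ⟨f₀, hf₀⟩ := hF
  set α := (512 * L ^ 4)⁻¹ with hα
  have hL0 : 0 < L := by linarith
  have hα1 : α ≤ 1 / 4 := by
    have : (1 : ℝ) ≤ L ^ 4 := one_le_pow₀ hL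
    rw [hα]
    refine (inv_anti₀ (by norm_num) (by linarith : (4 : ℝ) ≤ 512 * L ^ 4)).trans (by norm_num)
  -- The choice depends only on the class, the blocks, `L`, `r` and the data. The default `f₀` is
  -- never used on the good event, where `fstar` itself is accepted.
  refine ⟨fun D => if h : ∃ f : F, MedianCriterion F e (2 * α * r ^ 2) D f then h.choose
    else ⟨f₀, hf₀⟩, fun P _ fstar H => ?_⟩
  intro D hD
  by_contra hgood
  refine hD ?_
  simp only [Set.mem_union, Set.mem_ofPred_eq, not_or, not_exists, not_and, not_lt] at hgood
  obtain ⟨hstar, hall⟩ := medianCriterion_analysis hL0 hr hα hn hm e D H.minimizer.1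
    (fun f hf => H.integral_mul_noise_nonneg hf) (fun f hf => H.l2Radius_le_integral_abs hL0 hf)
    (fun f hf => hgood.1 ⟨f, hf⟩) (fun f hf => hgood.2 ⟨f, hf⟩)
  have hex : ∃ f : F, MedianCriterion F e (2 * α * r ^ 2) D f :=
    ⟨⟨fstar, H.minimizer.1⟩, hstar⟩
  simp only [Set.mem_ofPred_eq, dif_pos hex]
  set g := hex.choose
  obtain ⟨h1, h2⟩ := hall g.1 g.2 hex.choose_spec
  have h0 := l2Radius_nonneg P.fst fstar g.1
  refine ⟨?_, ?_⟩
  · have : eLpNorm (g.1 - fstar) 2 P.fst = ENNReal.ofReal (l2Radius P.fst fstar g.1) :=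
      eLpNorm_two_eq_ofReal_sqrt (H.memLp_sub g.2 H.minimizer.1)
    rw [this]
    exact ENNReal.ofReal_le_ofReal (by linarith)
  -- The excess risk is at most `4αr² + r²`, and `4α ≤ 1`.
  · rw [H.risk_eq g.2]
    have h3 : l2Radius P.fst fstar g.1 ^ 2 ≤ r ^ 2 := by gcongr
    have h4 : 4 * α * r ^ 2 ≤ r ^ 2 := by nlinarith [sq_nonneg r]
    nlinarith [sq_nonneg r]

/-- The factor 2 before `rStar` serves to make the inequalities strict, which provides a radius `ρ <
r` where each defining condition holds. -/
theorem lt_of_two_mul_le_ofReal {a b : ℝ≥0∞} {r : ℝ} (hr : 0 < r) (hab : a ≤ b)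
    (h : 2 * b ≤ ENNReal.ofReal r) : a < ENNReal.ofReal r := by
  refine hab.trans_lt (lt_of_not_ge fun hge => ?_)
  have h1 : 2 * ENNReal.ofReal r ≤ ENNReal.ofReal r := (mul_le_mul_right hge 2).trans h
  rw [← ENNReal.ofReal_ofNat 2, ← ENNReal.ofReal_mul (by norm_num),
    ENNReal.ofReal_le_ofReal_iff hr.le] at h1
  linarith

theorem complexities_lt_of_rStar_le {X : Type*} [MeasurableSpace X] {P : Measure (X × ℝ)}
    {F : Set (X → ℝ)} {N : ℕ} {σ c₁ c₂ r : ℝ} {h : X → ℝ} (hr : 0 < r)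
    (hrs : 2 * rStar P F N σ c₁ c₂ h ≤ ENNReal.ofReal r) :
    lambdaQ P.fst F N c₁ c₂ h < ENNReal.ofReal r ∧
      lambdaM P.fst F N (c₁ / σ) c₂ h < ENNReal.ofReal r ∧
      rE P.fst F N c₁ h < ENNReal.ofReal r ∧ rMbar P F N c₁ h < ENNReal.ofReal r :=
  ⟨lt_of_two_mul_le_ofReal hr ((le_max_left _ _).trans (le_max_left _ _)) hrs,
    lt_of_two_mul_le_ofReal hr ((le_max_right _ _).trans (le_max_left _ _)) hrs,
    lt_of_two_mul_le_ofReal hr ((le_max_left _ _).trans (le_max_right _ _)) hrs,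
    lt_of_two_mul_le_ofReal hr ((le_max_right _ _).trans (le_max_right _ _)) hrs⟩

/-- The case of a small sample, in which the class has radius less than `r` around `fstar`. -/
theorem LearningAssumption.measure_failure_le_of_small {X : Type*} [MeasurableSpace X]
    {P : Measure (X × ℝ)} [IsProbabilityMeasure P] {F : Set (X → ℝ)} {fstar : X → ℝ} {L σ : ℝ}
    (H : LearningAssumption P F fstar L σ) (hL : 0 < L) (hσ : 0 < σ) {r c₁ α β : ℝ}
    (hr : 0 < r) (hc₁ : 0 < c₁) (hα : 0 < α) {N : ℕ} (hN : 0 < N) (e : Fin 1 × Fin N ↪ Fin N)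
    (hrs : 2 * rStar P F N σ c₁ (1 / 2) fstar ≤ ENNReal.ofReal r)
    (hsmall : c₁ ^ 2 * (N * min 1 (r ^ 2 / σ ^ 2)) ≤ 1 / 2) (hc₁α : 16 * c₁ / α ≤ 1 / 2) :
    (Measure.pi fun _ : Fin N => P)
      ({D | ∃ f : F, ((1 : ℕ) : ℝ) / 8 < ∑ j, min 1 (|blockMean e
          (fun z : X × ℝ => localize P.fst fstar r f z.1 * (fstar z.1 - z.2)) D j -
          ∫ z, localize P.fst fstar r f z.1 * (fstar z.1 - z.2) ∂P| / (α * r ^ 2))} ∪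
      {D | ∃ f : F, r ≤ l2Radius P.fst fstar f ∧ ((1 : ℕ) : ℝ) / 8 < ∑ j, min 1 (|blockMean e
          (fun x => |localize P.fst fstar r f x|) (fun i => (D i).1) j -
          ∫ x, |localize P.fst fstar r f x| ∂P.fst| / β)}) ≤ ENNReal.ofReal (1 / 2) := by
  obtain ⟨hlQ, hlM, -, hrM⟩ := complexities_lt_of_rStar_le hr hrs
  -- The entropy bound comes from `lambdaQ` when `r ≥ σ` and from `lambdaM` otherwise; in both cases
  -- the logarithm is at most `1/2`.
  have hrad (f : F) : l2Radius P.fst fstar f < r := by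
    rcases le_total 1 (r ^ 2 / σ ^ 2) with h | h
    · rw [min_eq_left h, mul_one] at hsmall
      obtain ⟨ρ, hρ, hρr, hp⟩ := exists_of_infRadius_lt hlQ
      exact H.l2Radius_lt_of_packing hρ hρr (by norm_num) hsmall hp f.2
    · rw [min_eq_right h] at hsmall
      obtain ⟨ρ, hρ, hρr, hp⟩ := exists_of_infRadius_lt hlM
      refine H.l2Radius_lt_of_packing hρ hρr (by norm_num) ?_ hp f.2
      calc (c₁ / σ) ^ 2 * N * ρ ^ 2 ≤ (c₁ / σ) ^ 2 * N * r ^ 2 := by gcongr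
        _ = c₁ ^ 2 * (N * (r ^ 2 / σ ^ 2)) := by ring
        _ ≤ 1 / 2 := hsmall
  have hempty : {D : Fin N → X × ℝ | ∃ f : F, r ≤ l2Radius P.fst fstar f ∧
      ((1 : ℕ) : ℝ) / 8 < ∑ j, min 1 (|blockMean e
          (fun x => |localize P.fst fstar r f x|) (fun i => (D i).1) j -
          ∫ x, |localize P.fst fstar r f x| ∂P.fst| / β)} = ∅ := by
    ext D
    simp only [Set.mem_ofPred_eq, Set.mem_empty_iff_false, iff_false]
    rintro ⟨f, hf, -⟩
    exact absurd (hrad f) (not_lt.2 hf)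
  rw [hempty, Set.union_empty]
  obtain ⟨u, hum, huL, -, huR, hu⟩ := H.exists_multiplier_sequence hL hσ hr hc₁ hN hrM
  refine (hu 1 N e (((1 : ℕ) : ℝ) / 8) (α * r ^ 2)).trans ?_
  have h := measure_single_block_deviation P hN e u hum
    (fun k => (huL k).integrable (by norm_num)) (c₁ * r ^ 2 * N) (α * r ^ 2) (by positivity) huR
  rw [Nat.cast_one]
  refine h.trans (ENNReal.ofReal_le_ofReal (le_trans (le_of_eq ?_) hc₁α))
  have : (0 : ℝ) < N := by exact_mod_cast hN
  field_simp

/-- A union bound over the two deviations. `hM` and `hQ` say that the expected numbers of bad blocks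
are at most `n / 16`, with variance proxies `L⁴r²σ²` and `r²`. -/
theorem LearningAssumption.measure_failure_le {X : Type*} [MeasurableSpace X]
    {P : Measure (X × ℝ)} [IsProbabilityMeasure P] {F : Set (X → ℝ)} {fstar : X → ℝ} {L σ : ℝ}
    (H : LearningAssumption P F fstar L σ) (hL : 0 < L) (hσ : 0 < σ) {r c₁ c₂ α β : ℝ}
    (hr : 0 < r) (hc₁ : 0 < c₁) (hα : 0 < α) (hβ : 0 < β) {N n m : ℕ} (hN : 0 < N) (hn : 0 < n)
    (hm : 0 < m) (e : Fin n × Fin m ↪ Fin N)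
    (hrs : 2 * rStar P F N σ c₁ c₂ fstar ≤ ENNReal.ofReal r)
    (hM : n * (√(L ^ 4 * r ^ 2 * σ ^ 2 / m) / (α * r ^ 2)) +
      4 * (c₁ * r ^ 2 * N) / (m * (α * r ^ 2)) ≤ n / 16)
    (hQ : n * (√(r ^ 2 / m) / (β * r)) + 4 * (c₁ * r * N) / (m * (β * r)) ≤ n / 16) :
    (Measure.pi fun _ : Fin N => P)
      ({D | ∃ f : F, (n : ℝ) / 8 < ∑ j, min 1 (|blockMean e
          (fun z : X × ℝ => localize P.fst fstar r f z.1 * (fstar z.1 - z.2)) D j -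
          ∫ z, localize P.fst fstar r f z.1 * (fstar z.1 - z.2) ∂P| / (α * r ^ 2))} ∪
      {D | ∃ f : F, r ≤ l2Radius P.fst fstar f ∧ (n : ℝ) / 8 < ∑ j, min 1 (|blockMean e
          (fun x => |localize P.fst fstar r f x|) (fun i => (D i).1) j -
          ∫ x, |localize P.fst fstar r f x| ∂P.fst| / (β * r))}) ≤
      ENNReal.ofReal (2 * Real.exp (-(n : ℝ) / 512)) := by
  obtain ⟨-, -, hrE, hrM⟩ := complexities_lt_of_rStar_le hr hrs
  refine (measure_union_le _ _).trans ?_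
  rw [two_mul, ENNReal.ofReal_add (Real.exp_pos _).le (Real.exp_pos _).le]
  refine add_le_add ?_ ?_
  · obtain ⟨u, hum, huL, huv, huR, hu⟩ := H.exists_multiplier_sequence hL hσ hr hc₁ hN hrM
    refine (hu n m e _ _).trans (measure_block_deviation P hn hm e u hum huL
      (L ^ 4 * r ^ 2 * σ ^ 2) (c₁ * r ^ 2 * N) (α * r ^ 2) huv (by positivity) (fun K => ?_) hM)
    have hi (k : Fin (K + 1)) (i : Fin N) :
        Integrable (fun z : Fin N → X × ℝ => u k (z i)) (Measure.pi fun _ => P) :=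
      integrable_comp_eval (μ := fun _ : Fin N => P) ((huL k).integrable (by norm_num))
    have hm (k : Fin (K + 1)) (i : Fin N) :
        Measurable (fun z : Fin N → X × ℝ => u k (z i)) :=
      (hum k).comp (measurable_pi_apply i)
    exact (integral_mono (integrable_rademacherAverage hm hi)
      (integrable_absRademacherAverage hm hi) fun z => rademacherAverage_le_abs _).trans (huR K)
  · refine le_trans (measure_mono ?_)
      (H.measure_quadratic_deviation_le hL hr hc₁ hN hn hm e hrE (β * r) (by positivity) hQ)
    rintro D ⟨f, -, hf⟩
    exact ⟨f, hf⟩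

/-! ### Choice of the constants and of the number of blocks -/

/-- The procedure `Φ` is chosen before the law `P` of `(X, Y)`. The event need not be measurable, so
its probability is bounded from below through the outer measure of its complement. -/
theorem theorem2p5 (L : ℝ) (hL : 1 ≤ L) :
    ∃ c c₀ c₁ c₂ : ℝ, 0 < c ∧ 0 < c₀ ∧ 0 < c₁ ∧ 0 < c₂ ∧ c₂ < 1 ∧
      ∀ (X : Type*) [MeasurableSpace X] (F : Set (X → ℝ)), F.Nonempty →
      ∀ (N : ℕ) (σ r : ℝ), 0 < σ → 0 ≤ r →
      ∃ Φ : (Fin N → X × ℝ) → F,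
        ∀ (P : Measure (X × ℝ)) [IsProbabilityMeasure P] (fstar : X → ℝ),
          LearningAssumption P F fstar L σ →
          2 * rStar P F N σ c₁ c₂ fstar ≤ ENNReal.ofReal r →
          (Measure.pi fun _ : Fin N => P)
              {D | eLpNorm ((Φ D : X → ℝ) - fstar) 2 P.fst ≤ ENNReal.ofReal (c * r) ∧
                ∫ z, ((Φ D : X → ℝ) z.1 - z.2) ^ 2 ∂P ≤
                  ∫ z, (fstar z.1 - z.2) ^ 2 ∂P + (c * r) ^ 2}ᶜ ≤
            ENNReal.ofReal (Real.exp (-(c₀ * N * min 1 (r ^ 2 / σ ^ 2)))) := by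
  have hL0 : 0 < L := by linarith
  have hL4 : 1 ≤ L ^ 4 := one_le_pow₀ hL
  have hL2 : 1 ≤ L ^ 2 := one_le_pow₀ hL
  set α := (512 * L ^ 4)⁻¹ with hα
  have hαpos : 0 < α := by positivity
  have hα1 : α ≤ 1 / 512 := by
    rw [hα, ← one_div]
    exact one_div_le_one_div_of_le (by norm_num) (by linarith)
  -- Makes the multiplier standard deviation of a block at most `L²τ r² = α r² / 32` once `1/m ≤ τ²
  -- κ`.
  set τ := α / (32 * L ^ 2) with hτ
  have hτpos : 0 < τ := by positivity
  have hτα : L ^ 2 * τ = α / 32 := by rw [hτ]; field_simp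
  have hτα' : τ ≤ α / 32 := by nlinarith
  -- With `n ≤ θNκ` and `N ≤ 2nm`, this gives `1/m ≤ 2n/N ≤ τ² κ`.
  set θ := τ ^ 2 / 2 with hθ
  have hθpos : 0 < θ := by positivity
  have hθ1 : θ ≤ 1 := by rw [hθ]; nlinarith
  -- The value `c₁ = τ / 64` makes the Rademacher terms at most `n / 32` and gives `c₁² N κ = x /
  -- 2048`, which is below `1/2` when `x < 1024`.
  refine ⟨2, θ / 2048, τ / 64, 1 / 2, by norm_num, by positivity, by positivity, by norm_num,
    by norm_num, ?_⟩
  intro X _ F hF N σ r hσ hr0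
  rcases Nat.eq_zero_or_pos N with hN | hN
  · obtain ⟨f, hf⟩ := hF
    exact ⟨fun _ => ⟨f, hf⟩, fun P _ fstar _ _ => prob_le_one.trans (by simp [hN])⟩
  rcases hr0.eq_or_lt with hr | hr
  · obtain ⟨f, hf⟩ := hF
    exact ⟨fun _ => ⟨f, hf⟩, fun P _ fstar _ _ => prob_le_one.trans (by simp [← hr])⟩
  have hN' : (0 : ℝ) < N := by exact_mod_cast hN
  set κ := min 1 (r ^ 2 / σ ^ 2) with hκ
  have hκpos : 0 < κ := lt_min one_pos (by positivity)
  have hκ1 : κ ≤ 1 := min_le_left _ _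
  have hκr : κ ≤ r ^ 2 / σ ^ 2 := min_le_right _ _
  set x := θ * N * κ with hx
  have hxpos : 0 < x := by positivity
  have hxexp : θ / 2048 * N * κ = x / 2048 := by rw [hx]; ring
  rcases lt_or_ge x 1024 with hxs | hxl
  -- For `x < 1024` the target `exp (-x / 2048)` is at least `1/2`, so one block suffices.
  · set e : Fin 1 × Fin N ↪ Fin N := (Equiv.uniqueProd (Fin N) (Fin 1)).toEmbedding
    obtain ⟨Φ, hΦ⟩ := exists_medianOfMeans_procedure hF hL hr one_pos hN e σ
    refine ⟨Φ, fun P _ fstar H hrs => (measure_mono (hΦ P fstar H)).trans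
      ((H.measure_failure_le_of_small hL0 hσ hr (by positivity) hαpos hN e hrs ?_ ?_).trans
        (ENNReal.ofReal_le_ofReal ?_))⟩
    · have : (τ / 64) ^ 2 * (N * κ) = x / 2048 := by rw [hx, hθ]; ring
      rw [this]; linarith
    · rw [div_le_iff₀ hαpos]; linarith
    · rw [hxexp]
      have := Real.add_one_le_exp (-(x / 2048))
      linarith
  · set n := ⌊x⌋₊ with hn
    have hnx : (n : ℝ) ≤ x := Nat.floor_le hxpos.le
    have hxn : x < n + 1 := Nat.lt_floor_add_one x
    have hn1024 : 1024 ≤ n := Nat.le_floor (by exact_mod_cast hxl)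
    have hn1024' : (1024 : ℝ) ≤ n := by exact_mod_cast hn1024
    have hnpos : 0 < n := by omega
    have hnN : n ≤ N := by
      have h1 : x ≤ N := by
        rw [hx]
        calc θ * N * κ ≤ 1 * N * 1 := by gcongr
          _ = N := by ring
      exact_mod_cast hnx.trans h1
    set m := N / n with hm
    have hmpos : 0 < m := Nat.div_pos hnN hnpos
    have hm' : (0 : ℝ) < m := by exact_mod_cast hmpos
    have hnm : n * m ≤ N := Nat.mul_div_le N n
    -- Rounding `N / n` down to `m ≥ 1` loses at most a factor 2.
    have hN2 : (N : ℝ) ≤ 2 * n * m := by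
      have h1 : N < n * (m + 1) := Nat.lt_mul_div_succ N hnpos
      have h2 : n * 1 ≤ n * m := Nat.mul_le_mul_left n hmpos
      have h3 : N ≤ 2 * n * m := by nlinarith
      exact_mod_cast h3
    have hminv : (m : ℝ)⁻¹ ≤ τ ^ 2 * κ := by
      rw [inv_le_iff_one_le_mul₀ hm']
      have h1 : (N : ℝ) ≤ N * (τ ^ 2 * κ * m) := by
        calc (N : ℝ) ≤ 2 * n * m := hN2
          _ ≤ 2 * x * m := by gcongr
          _ = N * (τ ^ 2 * κ * m) := by rw [hx, hθ]; ring
      have h2 : N * 1 ≤ N * (τ ^ 2 * κ * m) := by linarith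
      exact le_of_mul_le_mul_left h2 hN'
    have hNm : (N : ℝ) / m ≤ 2 * n := by rw [div_le_iff₀ hm']; exact hN2
    let e : Fin n × Fin m ↪ Fin N := finProdFinEquiv.toEmbedding.trans (Fin.castLEEmb hnm)
    obtain ⟨Φ, hΦ⟩ := exists_medianOfMeans_procedure hF hL hr hnpos hmpos e σ
    refine ⟨Φ, fun P _ fstar H hrs => (measure_mono (hΦ P fstar H)).trans
      ((H.measure_failure_le hL0 hσ hr (by positivity) hαpos (by positivity) hN hnpos hmpos e
        hrs ?_ ?_).trans (ENNReal.ofReal_le_ofReal ?_))⟩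
    · have h1 : √(L ^ 4 * r ^ 2 * σ ^ 2 / m) ≤ L ^ 2 * τ * r ^ 2 := by
        refine (Real.sqrt_le_left (by positivity)).2 ?_
        calc L ^ 4 * r ^ 2 * σ ^ 2 / m = L ^ 4 * r ^ 2 * σ ^ 2 * (m : ℝ)⁻¹ := div_eq_mul_inv _ _
          _ ≤ L ^ 4 * r ^ 2 * σ ^ 2 * (τ ^ 2 * (r ^ 2 / σ ^ 2)) := by
              gcongr
              exact hminv.trans (by gcongr)
          _ = (L ^ 2 * τ * r ^ 2) ^ 2 := by field_simp
      have h2 : √(L ^ 4 * r ^ 2 * σ ^ 2 / m) / (α * r ^ 2) ≤ 1 / 32 := by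
        rw [div_le_iff₀ (by positivity)]
        refine h1.trans (le_of_eq ?_)
        rw [hτα]; ring
      have h3 : 4 * (τ / 64 * r ^ 2 * N) / (m * (α * r ^ 2)) = τ / (16 * α) * (N / m) := by
        field_simp; norm_num
      have h4 : τ / (16 * α) ≤ 1 / 64 := by
        rw [div_le_iff₀ (by positivity)]; linarith
      have h5 : τ / (16 * α) * (N / m) ≤ 1 / 64 * (2 * n) := by gcongr
      have h6 : n * (√(L ^ 4 * r ^ 2 * σ ^ 2 / m) / (α * r ^ 2)) ≤ n * (1 / 32) := by gcongr
      rw [h3]; linarith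
    · have h1 : √(r ^ 2 / m) ≤ τ * r := by
        refine (Real.sqrt_le_left (by positivity)).2 ?_
        calc r ^ 2 / m = r ^ 2 * (m : ℝ)⁻¹ := div_eq_mul_inv _ _
          _ ≤ r ^ 2 * (τ ^ 2 * 1) := by
              gcongr
              exact hminv.trans (by gcongr)
          _ = (τ * r) ^ 2 := by ring
      have h2 : √(r ^ 2 / m) / ((8 * L ^ 2)⁻¹ * r) ≤ 1 / 32 := by
        calc √(r ^ 2 / m) / ((8 * L ^ 2)⁻¹ * r) ≤ τ * r / ((8 * L ^ 2)⁻¹ * r) := by gcongr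
          _ = 8 * (L ^ 2 * τ) := by field_simp
          _ ≤ 1 / 32 := by rw [hτα]; linarith
      have h3 : 4 * (τ / 64 * r * N) / (m * ((8 * L ^ 2)⁻¹ * r)) = (L ^ 2 * τ) / 2 * (N / m) := by
        field_simp; norm_num
      have h4 : (L ^ 2 * τ) / 2 ≤ 1 / 64 := by rw [hτα]; linarith
      have h5 : (L ^ 2 * τ) / 2 * (N / m) ≤ 1 / 64 * (2 * n) := by gcongr
      have h6 : n * (√(r ^ 2 / m) / ((8 * L ^ 2)⁻¹ * r)) ≤ n * (1 / 32) := by gcongr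
      rw [h3]; linarith
    · rw [hxexp]
      -- Since `n ≥ 1024`, half of the exponent absorbs the factor 2 of the union bound; `x < n + 1
      -- ≤ 2n` then accounts for the rounding of `x`.
      have h1 : (2 : ℝ) ≤ Real.exp (n / 1024) := by
        have := Real.add_one_le_exp ((n : ℝ) / 1024)
        linarith
      calc 2 * Real.exp (-(n : ℝ) / 512)
          ≤ Real.exp (n / 1024) * Real.exp (-(n : ℝ) / 512) := by gcongr
        _ = Real.exp (-((n : ℝ) / 1024)) := by rw [← Real.exp_add]; congr 1; ring
        _ ≤ Real.exp (-(x / 2048)) := Real.exp_le_exp.2 (by linarith)
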